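/- Let $\mathbb D=\{z\in\mathbb C:|z|<1\}$, let $m_{\mathbb D}(a,b)=\left|\frac{a-b}{1-a\bar b}\right|$, and let $c_{\mathbb D}(a,b)=\frac12\log\frac{1+m_{\mathbb D}(a,b)}{1-m_{\mathbb D}(a,b)}$ be the Poincaré distance of $\mathbb D$ (which is also its Carathéodory distance). Let $1\le m\le n$ be relatively prime integers, let $A_{m,n}=\{(z,w)\in\mathbb D^2: z^m=w^n\}$, and let $p_{m,n}:\mathbb D\to A_{m,n}$, $p_{m,n}(\lambda)=(\lambda^n,\lambda^m)$. Let $\mathcal O(A_{m,n},\mathbb D)$ be the set of functions $f:A_{m,n}\to\mathbb D$ that are locally restrictions of holomorphic functions on open subsets of $\mathbb C^2$. The Carathéodory distance of $A_{m,n}$ is $$c_{A_{m,n}}(\zeta,\eta)=\tanh^{-1}\sup\{m_{\mathbb D}(f(\zeta),f(\eta)): f\in\mathcal O(A_{m,n},\mathbb D)\},$$ and the associated inner distance $c^i_{A_{m,n}}(\zeta,\eta)$ is the infimum of the $c_{A_{m,n}}$-lengths of all curves in $A_{m,n}$ that join $\zeta$ to $\eta$ and are rectifiable with respect to the Euclidean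 norm, where the $c_{A_{m,n}}$-length of a curve $\alpha:[0,1]\to A_{m,n}$ is the supremum of $\sum_{j=1}^{N} c_{A_{m,n}}(\alpha(t_{j-1}),\alpha(t_j))$ over all partitions $0=t_0\le t_1\le\dots\le t_N=1$. Then for all $\lambda,\mu\in\mathbb D$, $$c^i_{A_{m,n}}(p_{m,n}(\lambda),p_{m,n}(\mu))=\begin{cases} c_{\mathbb D}(\lambda^m,\mu^m) & \text{if } \operatorname{Re}(\lambda\bar\mu)\ge\cos(\pi/m)\,|\lambda\mu|,\\ c_{\mathbb D}(\lambda^m,0)+c_{\mathbb D}(0,\mu^m) & \text{otherwise.}\end{cases}$$ -/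

import Mathlib

open scoped ENNReal

namespace NeilParabola

noncomputable section

/-- The Möbius distance `m_𝔻(a, b) = |(a - b) / (1 - a b̄)|` on the open unit disc. -/
def mobiusDist (a b : ℂ) : ℝ :=
  ‖(a - b) / (1 - a * (starRingEnd ℂ) b)‖

/-- The Poincaré distance of the open unit disc (curvature `-4` normalization),
which is the Carathéodory distance `c_𝔻` of the disc. -/
def poincareDist (a b : ℂ) : ℝ :=
  (1 / 2) * Real.log ((1 + mobiusDist a b) / (1 - mobiusDist a b))

/-- The generalized Neil parabola `A_{m,n} = {(z, w) ∈ 𝔻² : z ^ m = w ^ n}`. -/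
def parabola (m n : ℕ) : Set (ℂ × ℂ) :=
  {x | ‖x.1‖ < 1 ∧ ‖x.2‖ < 1 ∧ x.1 ^ m = x.2 ^ n}

/-- The parametrization `p_{m,n}(ζ) = (ζ ^ n, ζ ^ m)`. -/
def param (m n : ℕ) (ζ : ℂ) : ℂ × ℂ :=
  (ζ ^ n, ζ ^ m)

/-- `f` is a holomorphic function on `A ⊆ ℂ²`: near each point of `A` it is the restriction to
`A` of a holomorphic function on an open subset of `ℂ²`. Values of `f` off `A` are irrelevant. -/
def HolomorphicOnVariety (A : Set (ℂ × ℂ)) (f : ℂ × ℂ → ℂ) : Prop :=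
  ∀ x ∈ A, ∃ U : Set (ℂ × ℂ), IsOpen U ∧ x ∈ U ∧
    ∃ F : ℂ × ℂ → ℂ, DifferentiableOn ℂ F U ∧ ∀ y ∈ U ∩ A, f y = F y

/-- The Möbius pseudodistance `m_A(x, y) = sup {m_𝔻(f x, f y) : f ∈ 𝒪(A, 𝔻)}`.
The set is nonempty (constants) and bounded above by `1`. -/
def caratheodoryMobius (A : Set (ℂ × ℂ)) (x y : ℂ × ℂ) : ℝ :=
  sSup {r : ℝ | ∃ f : ℂ × ℂ → ℂ, HolomorphicOnVariety A f ∧ (∀ z ∈ A, ‖f z‖ < 1) ∧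
    r = mobiusDist (f x) (f y)}

/-- The Carathéodory distance `c_A = artanh m_A`. -/
def caratheodoryDist (A : Set (ℂ × ℂ)) (x y : ℂ × ℂ) : ℝ :=
  Real.artanh (caratheodoryMobius A x y)

/-- The length of the curve `α : [0, 1] → X` with respect to `d`: the supremum of
`∑ d (α (u i)) (α (u (i + 1)))` over all finite partitions `u 0 ≤ u 1 ≤ ⋯ ≤ u k` in `[0, 1]`. -/
def curveLength {X : Type*} (d : X → X → ℝ) (α : ℝ → X) : ℝ≥0∞ :=
  ⨆ p : ℕ × {u : ℕ → ℝ // Monotone u ∧ ∀ i, u i ∈ Set.Icc (0 : ℝ) 1},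
    ∑ i ∈ Finset.range p.1, ENNReal.ofReal (d (α (p.2.1 i)) (α (p.2.1 (i + 1))))

/-- `α : [0, 1] → A` is a norm-rectifiable curve in `A` from `x` to `y`. (Rectifiability is the
same for all norms on `ℂ²`.) -/
structure IsRectifiableCurve (A : Set (ℂ × ℂ)) (x y : ℂ × ℂ) (α : ℝ → ℂ × ℂ) : Prop where
  continuousOn : ContinuousOn α (Set.Icc 0 1)
  boundedVariation : BoundedVariationOn α (Set.Icc 0 1)
  mem : ∀ t ∈ Set.Icc (0 : ℝ) 1, α t ∈ A
  source : α 0 = x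
  target : α 1 = y

/-- The inner Carathéodory distance `c_A^i(x, y)`: the infimum of the `c_A`-lengths of all
norm-rectifiable curves in `A` joining `x` to `y`. -/
def innerCaratheodoryDist (A : Set (ℂ × ℂ)) (x y : ℂ × ℂ) : ℝ≥0∞ :=
  ⨅ (α : ℝ → ℂ × ℂ) (_ : IsRectifiableCurve A x y α), curveLength (caratheodoryDist A) α

end

end NeilParabola

/-!
# The inner Carathéodory distance of the generalized Neil parabola

Pulling back along the bijection `p = param m n` turns a holomorphic function on `A = parabola m n`
into a holomorphic function `h` on the disc with `h z = h 0 + O(z ^ m)`, because both coordinates of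
`p z` are `O(z ^ m)`. The proof compares the geometry of `A` with that of the disc through the map
`z ↦ z ^ m`, which is the second coordinate of `p`.

*Lower bound.* The second coordinate is a holomorphic function from `A` to the disc, so `c_A` of two
points `p a`, `p b` is at least the Poincaré distance of `a ^ m` and `b ^ m`. If the angle between
`a` and `b` exceeds `π / m`, then on every curve from `p a` to `p b` there is by the intermediate
value theorem a point `p c` such that `c` is at angle exactly `π / m` to `a`, or is `0`. The origin
lies on the geodesic from `a ^ m` to `c ^ m`, and the triangle inequality gives the bound by the sum
of the two distances to the origin (`le_curveLength`).

*Upper bound.* After a Möbius transformation `h 0 = 0`, hence `h z = z ^ m * g z` with `|g| ≤ 1`.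
The Schwarz–Pick lemma for `g` and an elementary inequality show that the hyperbolic derivative
of `h` is at most that of `z ↦ z ^ m` (`norm_deriv_mul_le_of_isBigO`). Therefore `h` does not
increase the length of a curve that is measured after applying `z ↦ z ^ m`
(`poincareDist_le_of_speed_le`). If the angle between `a` and `b` is less than `π / m`, the geodesic
from `a ^ m` to `b ^ m` has an `m`-th root joining `a` to `b`, and this curve realizes the Poincaré
distance (`innerCaratheodoryDist_le_poincareDist`). In the remaining cases two radial segments
through the origin realize the sum of the distances to the origin (`innerCaratheodoryDist_le_add`).
For the angle `π / m` itself the two formulas agree (`poincareDist_pow_eq_add`).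
-/

namespace NeilParabola

open Complex Metric Set Filter Topology ComplexConjugate

/-! ### Möbius transformations and the Poincaré distance of the disc -/

/-- The automorphism `z ↦ (z - c) / (1 - c̄ z)` of the disc, which sends `c` to `0`. -/
noncomputable def mobius (c z : ℂ) : ℂ :=
  (z - c) / (1 - conj c * z)

lemma mobius_den_ne_zero {c z : ℂ} (hc : ‖c‖ < 1) (hz : ‖z‖ ≤ 1) : 1 - conj c * z ≠ 0 := by
  intro h
  have h1 : ‖conj c * z‖ = 1 := by
    rw [← sub_eq_zero.1 h, norm_one]
  rw [norm_mul, norm_conj] at h1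
  nlinarith [norm_nonneg c, norm_nonneg z]

@[simp] lemma mobius_self (c : ℂ) : mobius c c = 0 := by simp [mobius]

lemma one_sub_norm_mobius_sq {c z : ℂ} (h : 1 - conj c * z ≠ 0) :
    1 - ‖mobius c z‖ ^ 2 = (1 - ‖c‖ ^ 2) * (1 - ‖z‖ ^ 2) / ‖1 - conj c * z‖ ^ 2 := by
  have h' : ‖1 - conj c * z‖ ^ 2 ≠ 0 := by simpa using h
  rw [mobius, norm_div, div_pow, eq_div_iff h', sub_mul, div_mul_cancel₀ _ h']
  simp only [← normSq_eq_norm_sq, normSq_apply, sub_re, sub_im, mul_re, mul_im, conj_re, conj_im,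
    one_re, one_im]
  ring

lemma norm_mobius_lt_one {c z : ℂ} (hc : ‖c‖ < 1) (hz : ‖z‖ < 1) : ‖mobius c z‖ < 1 := by
  have h := mobius_den_ne_zero hc hz.le
  have h1 := one_sub_norm_mobius_sq h
  have h2 : 0 < (1 - ‖c‖ ^ 2) * (1 - ‖z‖ ^ 2) / ‖1 - conj c * z‖ ^ 2 := by
    have : 0 < ‖1 - conj c * z‖ := norm_pos_iff.2 h
    have : 0 < 1 - ‖c‖ ^ 2 := by nlinarith [norm_nonneg c]
    have : 0 < 1 - ‖z‖ ^ 2 := by nlinarith [norm_nonneg z]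
    positivity
  nlinarith [norm_nonneg (mobius c z)]

lemma norm_mobius_le_one {c z : ℂ} (hc : ‖c‖ < 1) (hz : ‖z‖ ≤ 1) : ‖mobius c z‖ ≤ 1 := by
  have h := mobius_den_ne_zero hc hz
  have h1 := one_sub_norm_mobius_sq h
  have h2 : 0 ≤ (1 - ‖c‖ ^ 2) * (1 - ‖z‖ ^ 2) / ‖1 - conj c * z‖ ^ 2 := by
    have : 0 ≤ 1 - ‖c‖ ^ 2 := by nlinarith [norm_nonneg c]
    have : 0 ≤ 1 - ‖z‖ ^ 2 := by nlinarith [norm_nonneg z]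
    positivity
  nlinarith [norm_nonneg (mobius c z)]

lemma hasDerivAt_mobius {c z : ℂ} (h : 1 - conj c * z ≠ 0) :
    HasDerivAt (mobius c) ((1 - ‖c‖ ^ 2 : ℝ) / (1 - conj c * z) ^ 2) z := by
  have h1 := ((hasDerivAt_id z).sub_const c).div
    (((hasDerivAt_id z).const_mul (conj c)).const_sub 1) h
  refine h1.congr_deriv ?_
  have : ((1 - ‖c‖ ^ 2 : ℝ) : ℂ) = 1 - conj c * c := by
    rw [← normSq_eq_norm_sq, ofReal_sub, normSq_eq_conj_mul_self, ofReal_one]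
  rw [this]
  simp only [id]
  ring

/-- Differential form of the Möbius invariance of the Poincaré metric `|dz| / (1 - |z|²)`. -/
lemma norm_deriv_mobius_mul {c z : ℂ} (hc : ‖c‖ < 1) (hz : ‖z‖ ≤ 1) :
    ‖((1 - ‖c‖ ^ 2 : ℝ) / (1 - conj c * z) ^ 2 : ℂ)‖ * (1 - ‖z‖ ^ 2) = 1 - ‖mobius c z‖ ^ 2 := by
  rw [one_sub_norm_mobius_sq (mobius_den_ne_zero hc hz), norm_div, norm_pow, norm_real,
    Real.norm_of_nonneg (by nlinarith [norm_nonneg c])]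
  ring

lemma mobius_neg_mobius {c z : ℂ} (hc : ‖c‖ < 1) (hz : ‖z‖ < 1) :
    mobius (-c) (mobius c z) = z := by
  have h := mobius_den_ne_zero hc hz.le
  have h' := mobius_den_ne_zero hc hc.le
  have e1 : (z - c) / (1 - conj c * z) - -c = z * (1 - conj c * c) / (1 - conj c * z) := by
    rw [eq_div_iff h, sub_mul, div_mul_cancel₀ _ h]
    ring
  have e2 : 1 - -conj c * ((z - c) / (1 - conj c * z)) = (1 - conj c * c) / (1 - conj c * z) := by
    rw [eq_div_iff h, sub_mul, mul_assoc, div_mul_cancel₀ _ h]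
    ring
  rw [mobius, mobius, map_neg, e1, e2, div_div_div_cancel_right₀ h, mul_div_cancel_right₀ _ h']

lemma mobiusDist_eq (a b : ℂ) : mobiusDist a b = ‖mobius b a‖ := by
  rw [mobiusDist, mobius, mul_comm]

lemma mobiusDist_nonneg (a b : ℂ) : 0 ≤ mobiusDist a b := norm_nonneg _

lemma mobiusDist_comm (a b : ℂ) : mobiusDist a b = mobiusDist b a := by
  rw [mobiusDist, mobiusDist, norm_div, norm_div, norm_sub_rev a b, ← norm_conj (1 - a * _)]
  simp [mul_comm]

lemma mobiusDist_lt_one {a b : ℂ} (ha : ‖a‖ < 1) (hb : ‖b‖ < 1) : mobiusDist a b < 1 := by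
  rw [mobiusDist_eq]
  exact norm_mobius_lt_one hb ha

@[simp] lemma mobiusDist_zero_right (a : ℂ) : mobiusDist a 0 = ‖a‖ := by simp [mobiusDist]

@[simp] lemma mobiusDist_zero_left (a : ℂ) : mobiusDist 0 a = ‖a‖ := by simp [mobiusDist]

lemma mobiusDist_mobius {a b c : ℂ} (ha : ‖a‖ < 1) (hb : ‖b‖ < 1) (hc : ‖c‖ < 1) :
    mobiusDist (mobius c a) (mobius c b) = mobiusDist a b := by
  have h1 := mobius_den_ne_zero hc ha.le
  have h2 := mobius_den_ne_zero hc hb.le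
  have h3 := mobius_den_ne_zero hc hc.le
  have h4 : 1 - c * conj b ≠ 0 := by
    simpa using (map_ne_zero conj).2 h2
  have h5 := mobius_den_ne_zero hb ha.le
  have h5' : 1 - a * conj b ≠ 0 := by rwa [mul_comm]
  have key : (mobius c a - mobius c b) / (1 - mobius c a * conj (mobius c b)) =
      ((a - b) / (1 - a * conj b)) * ((1 - c * conj b) / (1 - conj c * b)) := by
    have e1 : mobius c a - mobius c b =
        (a - b) * (1 - conj c * c) / ((1 - conj c * a) * (1 - conj c * b)) := by
      rw [mobius, mobius, div_sub_div _ _ h1 h2]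
      ring
    have e2 : 1 - mobius c a * conj (mobius c b) =
        (1 - a * conj b) * (1 - conj c * c) / ((1 - conj c * a) * (1 - c * conj b)) := by
      rw [mobius, mobius, map_div₀]
      simp only [map_sub, map_mul, map_one, conj_conj]
      rw [div_mul_div_comm, one_sub_div (mul_ne_zero h1 h4)]
      ring
    rw [e1, e2, div_mul_div_comm, div_div_div_eq, div_eq_div_iff
      (mul_ne_zero (mul_ne_zero h1 h2) (mul_ne_zero h5' h3)) (mul_ne_zero h5' h2)]
    ring
  have h6 : ‖(1 - c * conj b) / (1 - conj c * b)‖ = 1 := by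
    have : 1 - c * conj b = conj (1 - conj c * b) := by simp
    rw [this, norm_div, norm_conj, div_self (norm_ne_zero_iff.2 h2)]
  rw [mobiusDist, key, norm_mul, h6, mul_one, mobiusDist]

lemma poincareDist_eq_artanh {a b : ℂ} (ha : ‖a‖ < 1) (hb : ‖b‖ < 1) :
    poincareDist a b = Real.artanh (mobiusDist a b) := by
  rw [poincareDist, Real.artanh_eq_half_log]
  exact ⟨by linarith [mobiusDist_nonneg a b], (mobiusDist_lt_one ha hb).le⟩

lemma poincareDist_comm (a b : ℂ) : poincareDist a b = poincareDist b a := by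
  rw [poincareDist, poincareDist, mobiusDist_comm]

lemma poincareDist_nonneg {a b : ℂ} (ha : ‖a‖ < 1) (hb : ‖b‖ < 1) : 0 ≤ poincareDist a b := by
  rw [poincareDist_eq_artanh ha hb]
  exact Real.artanh_nonneg (mobiusDist_nonneg a b)

lemma artanh_add_artanh {x y : ℝ} (hx0 : 0 ≤ x) (hx : x < 1) (hy0 : 0 ≤ y) (hy : y < 1) :
    Real.artanh x + Real.artanh y = Real.artanh ((x + y) / (1 + x * y)) := by
  have hd : 0 < 1 + x * y := by positivity
  have hlt : (x + y) / (1 + x * y) < 1 := by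
    rw [div_lt_one hd]
    nlinarith
  have h0 : 0 ≤ (x + y) / (1 + x * y) := by positivity
  rw [Real.artanh_eq_half_log ⟨by linarith, hx.le⟩, Real.artanh_eq_half_log ⟨by linarith, hy.le⟩,
    Real.artanh_eq_half_log ⟨by linarith, hlt.le⟩, ← mul_add, ← Real.log_mul]
  · congr 2
    have h1 : 1 - x ≠ 0 := by linarith
    have h2 : 1 - y ≠ 0 := by linarith
    have h3 : 1 - (x + y) / (1 + x * y) ≠ 0 := by linarith
    have h4 : 1 + x * y - (x + y) ≠ 0 := by
      have : 1 + x * y - (x + y) = (1 - x) * (1 - y) := by ring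
      rw [this]
      exact mul_ne_zero h1 h2
    rw [div_mul_div_comm, div_eq_div_iff (mul_ne_zero h1 h2) h3]
    field_simp
    ring
  · exact (div_pos (by linarith) (by linarith)).ne'
  · exact (div_pos (by linarith) (by linarith)).ne'

lemma poincareDist_zero_add {a b : ℂ} (ha : ‖a‖ < 1) (hb : ‖b‖ < 1) :
    poincareDist a 0 + poincareDist 0 b =
      Real.artanh ((‖a‖ + ‖b‖) / (1 + ‖a‖ * ‖b‖)) := by
  have h0 : ‖(0 : ℂ)‖ < 1 := by simp
  rw [poincareDist_eq_artanh ha h0, poincareDist_eq_artanh h0 hb, mobiusDist_zero_left,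
    mobiusDist_zero_right, artanh_add_artanh (norm_nonneg _) ha (norm_nonneg _) hb]

/-- `0` lies on the geodesic between points with opposite directions. -/
lemma poincareDist_eq_add_of_opposite {a b : ℂ} (ha : ‖a‖ < 1) (hb : ‖b‖ < 1)
    (h : a * conj b = -(‖a‖ * ‖b‖ : ℝ)) :
    poincareDist a b = poincareDist a 0 + poincareDist 0 b := by
  rw [poincareDist_zero_add ha hb, poincareDist_eq_artanh ha hb]
  congr 1
  have h1 : ‖a - b‖ = ‖a‖ + ‖b‖ := by
    have : ‖a - b‖ ^ 2 = (‖a‖ + ‖b‖) ^ 2 := by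
      have h2 := congrArg re h
      rw [← normSq_eq_norm_sq, normSq_sub, h2, normSq_eq_norm_sq, normSq_eq_norm_sq, neg_re,
        ofReal_re]
      ring
    exact (sq_eq_sq₀ (norm_nonneg _) (by positivity)).1 this
  rw [mobiusDist, norm_div, h1, h, sub_neg_eq_add]
  congr 1
  rw [← ofReal_one, ← ofReal_add, norm_real, Real.norm_of_nonneg (by positivity)]

lemma mobiusDist_le_add_div {a b : ℂ} (ha : ‖a‖ < 1) (hb : ‖b‖ < 1) :
    mobiusDist a b ≤ (‖a‖ + ‖b‖) / (1 + ‖a‖ * ‖b‖) := by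
  have h := mobius_den_ne_zero hb ha.le
  have h1 := one_sub_norm_mobius_sq h
  have h2 : ‖1 - conj b * a‖ ≤ 1 + ‖a‖ * ‖b‖ := by
    refine (norm_sub_le _ _).trans_eq ?_
    rw [norm_one, norm_mul, norm_conj, mul_comm]
  have h3 : 0 < ‖1 - conj b * a‖ := norm_pos_iff.2 h
  have h4 : (1 - ‖b‖ ^ 2) * (1 - ‖a‖ ^ 2) / (1 + ‖a‖ * ‖b‖) ^ 2 ≤
      (1 - ‖b‖ ^ 2) * (1 - ‖a‖ ^ 2) / ‖1 - conj b * a‖ ^ 2 := by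
    have : 0 ≤ 1 - ‖a‖ ^ 2 := by nlinarith [norm_nonneg a]
    have : 0 ≤ 1 - ‖b‖ ^ 2 := by nlinarith [norm_nonneg b]
    gcongr
  have h5 : (1 - ‖b‖ ^ 2) * (1 - ‖a‖ ^ 2) / (1 + ‖a‖ * ‖b‖) ^ 2 =
      1 - ((‖a‖ + ‖b‖) / (1 + ‖a‖ * ‖b‖)) ^ 2 := by
    have : 1 + ‖a‖ * ‖b‖ ≠ 0 := by positivity
    field_simp
    ring
  rw [mobiusDist_eq]
  refine le_of_sq_le_sq ?_ (by positivity)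
  linarith

lemma poincareDist_le_zero_add {a b : ℂ} (ha : ‖a‖ < 1) (hb : ‖b‖ < 1) :
    poincareDist a b ≤ poincareDist a 0 + poincareDist 0 b := by
  rw [poincareDist_zero_add ha hb, poincareDist_eq_artanh ha hb]
  have hd : 0 < 1 + ‖a‖ * ‖b‖ := by positivity
  refine Real.artanh_le_artanh (by linarith [mobiusDist_nonneg a b]) ?_
    (mobiusDist_le_add_div ha hb)
  rw [div_lt_one hd]
  nlinarith

lemma poincareDist_triangle {a b c : ℂ} (ha : ‖a‖ < 1) (hb : ‖b‖ < 1) (hc : ‖c‖ < 1) :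
    poincareDist a c ≤ poincareDist a b + poincareDist b c := by
  have h := poincareDist_le_zero_add (norm_mobius_lt_one hb ha) (norm_mobius_lt_one hb hc)
  rw [← mobius_self b] at h
  simpa only [poincareDist, mobiusDist_mobius ha hc hb, mobiusDist_mobius ha hb hb,
    mobiusDist_mobius hb hc hb] using h

lemma hasDerivAt_artanh {x : ℝ} (hx : |x| < 1) :
    HasDerivAt Real.artanh (1 / (1 - x ^ 2)) x := by
  obtain ⟨h1, h2⟩ := abs_lt.1 hx
  have hd : HasDerivAt (fun y : ℝ ↦ 1 / 2 * Real.log ((1 + y) / (1 - y)))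
      (1 / (1 - x ^ 2)) x := by
    have h3 := (((hasDerivAt_id x).const_add 1).div ((hasDerivAt_id x).const_sub 1)
      (by simp; linarith)).log (div_pos (by simp; linarith) (by simp; linarith)).ne'
    refine (h3.const_mul (1 / 2)).congr_deriv ?_
    have e1 : 1 - x ≠ 0 := by linarith
    have e2 : 1 + x ≠ 0 := by linarith
    have e3 : 1 - x ^ 2 ≠ 0 := by nlinarith
    simp only [id, Pi.div_apply]
    field_simp
    ring
  refine hd.congr_of_eventuallyEq ?_
  filter_upwards [Icc_mem_nhds h1 h2] with y hy using Real.artanh_eq_half_log hy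

/-- A curve `k` in the disc whose Poincaré speed is at most `T'` moves by at most the increment
of `T`. Moving the starting point to `0` and projecting to the direction of the end point reduces
this to the monotonicity of the real function `T - artanh ∘ Re`. -/
lemma poincareDist_le_of_speed_le {k : ℝ → ℂ} {k' : ℝ → ℂ} {T T' : ℝ → ℝ} {x y : ℝ} (hxy : x ≤ y)
    (hk1 : ∀ t ∈ Icc x y, ‖k t‖ < 1) (hk : ∀ t ∈ Icc x y, HasDerivAt k (k' t) t)
    (hT : ∀ t ∈ Icc x y, HasDerivAt T (T' t) t)
    (hle : ∀ t ∈ Icc x y, ‖k' t‖ ≤ (1 - ‖k t‖ ^ 2) * T' t) :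
    poincareDist (k x) (k y) ≤ T y - T x := by
  have hx : x ∈ Icc x y := left_mem_Icc.2 hxy
  have hy : y ∈ Icc x y := right_mem_Icc.2 hxy
  set c := k x with hc
  have hc1 : ‖c‖ < 1 := hk1 x hx
  set f : ℝ → ℂ := fun t ↦ mobius c (k t) with hf
  -- `e` rotates `f y` to the positive reals; if `f y = 0` it is `0`, which is harmless.
  set e : ℂ := conj (f y) / ‖f y‖ with he
  have he1 : ‖e‖ ≤ 1 := by
    rw [he, norm_div, norm_conj, norm_real, norm_norm]
    exact div_self_le_one _
  have hey : e * f y = (‖f y‖ : ℝ) := by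
    rcases eq_or_ne (f y) 0 with h0 | h0
    · simp [h0]
    · have : (‖f y‖ : ℂ) ≠ 0 := by simpa using h0
      rw [he, div_mul_eq_mul_div, ← normSq_eq_conj_mul_self, normSq_eq_norm_sq, ofReal_pow]
      field_simp
  have hf1 : ∀ t ∈ Icc x y, ‖f t‖ < 1 := fun t ht ↦ norm_mobius_lt_one hc1 (hk1 t ht)
  have hre : ∀ t, |(e * f t).re| ≤ ‖f t‖ := fun t ↦ by
    refine (abs_re_le_norm _).trans ?_
    rw [norm_mul]
    nlinarith [norm_nonneg (f t)]
  have hder : ∀ t ∈ Icc x y, ∃ d, HasDerivAt (fun t ↦ Real.artanh (e * f t).re) d t ∧ d ≤ T' t := by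
    intro t ht
    have h1 := mobius_den_ne_zero hc1 (hk1 t ht).le
    have h2 : HasDerivAt f _ t := (hasDerivAt_mobius h1).comp t (hk t ht)
    have h3 : HasDerivAt (fun t ↦ (e * f t).re) _ t :=
      reCLM.hasFDerivAt.comp_hasDerivAt t (h2.const_mul e)
    have h4 := (hre t).trans_lt (hf1 t ht)
    have h5 : HasDerivAt (fun t ↦ Real.artanh (e * f t).re) _ t :=
      HasDerivAt.comp (h₂ := Real.artanh) t (hasDerivAt_artanh h4) h3
    refine ⟨_, h5, ?_⟩
    have h6 : 0 < 1 - ((e * f t).re) ^ 2 := by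
      have := sq_lt_one_iff_abs_lt_one ((e * f t).re) |>.2 h4
      linarith
    rw [div_mul_eq_mul_div, one_mul, div_le_iff₀ h6]
    have h7 : 0 ≤ T' t := by
      have h8 : 0 < 1 - ‖k t‖ ^ 2 := by nlinarith [hk1 t ht, norm_nonneg (k t)]
      exact nonneg_of_mul_nonneg_right ((norm_nonneg _).trans (hle t ht)) h8
    set D : ℂ := ((1 - ‖c‖ ^ 2 : ℝ) / (1 - conj c * k t) ^ 2 : ℂ) with hD
    calc (e * (D * k' t)).re ≤ ‖e * (D * k' t)‖ := re_le_norm _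
      _ = ‖e‖ * (‖D‖ * ‖k' t‖) := by rw [norm_mul, norm_mul]
      _ ≤ 1 * (‖D‖ * ((1 - ‖k t‖ ^ 2) * T' t)) := by
        gcongr
        exact hle t ht
      _ = T' t * (1 - ‖f t‖ ^ 2) := by
        rw [hf, ← norm_deriv_mobius_mul hc1 (hk1 t ht).le]
        ring
      _ ≤ T' t * (1 - ((e * f t).re) ^ 2) := by
        rw [← sq_abs (e * f t).re]
        have := hre t
        gcongr
  choose! d hd hdle using hder
  have hmono : MonotoneOn (fun t ↦ T t - Real.artanh (e * f t).re) (Icc x y) := by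
    have hs : ∀ t ∈ Icc x y,
        HasDerivAt (fun t ↦ T t - Real.artanh (e * f t).re) (T' t - d t) t :=
      fun t ht ↦ (hT t ht).sub (hd t ht)
    refine monotoneOn_of_hasDerivWithinAt_nonneg (f' := fun t ↦ T' t - d t) (convex_Icc x y)
      (fun t ht ↦ (hs t ht).continuousAt.continuousWithinAt)
      (fun t ht ↦ (hs t (interior_subset ht)).hasDerivWithinAt)
      (fun t ht ↦ sub_nonneg.2 (hdle t (interior_subset ht)))
  have h := hmono hx hy hxy
  have hfx : f x = 0 := mobius_self c
  simp only [hfx, mul_zero, zero_re, Real.artanh_zero, sub_zero, hey, ofReal_re] at h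
  rw [poincareDist_comm, poincareDist_eq_artanh (hk1 y hy) hc1, mobiusDist_eq]
  linarith

/-! ### A Schwarz–Pick inequality for functions with a high order contact at the origin -/

/-- The infinitesimal **Schwarz–Pick lemma**, for maps into the closed disc. -/
lemma norm_deriv_mul_le_of_mapsTo_closedBall {g : ℂ → ℂ} (hg : DifferentiableOn ℂ g (ball 0 1))
    (hg1 : ∀ z ∈ ball (0 : ℂ) 1, ‖g z‖ ≤ 1) {z : ℂ} (hz : ‖z‖ < 1) :
    ‖deriv g z‖ * (1 - ‖z‖ ^ 2) ≤ 1 - ‖g z‖ ^ 2 := by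
  have hzb : z ∈ ball (0 : ℂ) 1 := by simpa using hz
  have hz2 : 0 < 1 - ‖z‖ ^ 2 := by nlinarith [norm_nonneg z]
  rcases (hg1 z hzb).lt_or_eq with hlt | heq
  · have hneg : ‖-z‖ < 1 := by rwa [norm_neg]
    have hmaps : ∀ u ∈ ball (0 : ℂ) 1, mobius (-z) u ∈ ball (0 : ℂ) 1 := fun u hu ↦ by
      rw [mem_ball_zero_iff] at hu ⊢
      exact norm_mobius_lt_one hneg hu
    set f : ℂ → ℂ := fun u ↦ mobius (g z) (g (mobius (-z) u)) with hf
    have hder : ∀ u ∈ ball (0 : ℂ) 1, HasDerivAt f _ u := fun u hu ↦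
      HasDerivAt.comp (h₂ := mobius (g z)) u
        (hasDerivAt_mobius (mobius_den_ne_zero hlt (hg1 _ (hmaps u hu))))
        ((hg.hasDerivAt (isOpen_ball.mem_nhds (hmaps u hu))).comp u
          (hasDerivAt_mobius (mobius_den_ne_zero hneg (mem_ball_zero_iff.1 hu).le)))
    have h0 : mobius (-z) 0 = z := by simp [mobius]
    have hf0 : f 0 = 0 := by simp [hf, h0]
    have hle := norm_deriv_le_one_of_mapsTo_ball (f := f) (c := 0) (R := 1)
      (fun u hu ↦ (hder u hu).differentiableAt.differentiableWithinAt)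
      (fun u hu ↦ by
        rw [hf0, mem_closedBall_zero_iff]
        exact norm_mobius_le_one hlt (hg1 _ (hmaps u hu))) one_pos
    have h0b : (0 : ℂ) ∈ ball (0 : ℂ) 1 := by simp
    have h2 := norm_deriv_mobius_mul hlt hlt.le
    rw [(hder 0 h0b).deriv, h0, norm_mul, norm_mul] at hle
    rw [mobius_self, norm_zero] at h2
    have h3 : ‖((1 - ‖-z‖ ^ 2 : ℝ) / (1 - conj (-z) * 0) ^ 2 : ℂ)‖ = 1 - ‖z‖ ^ 2 := by
      rw [mul_zero, sub_zero, one_pow, div_one, norm_real, norm_neg, Real.norm_of_nonneg hz2.le]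
    rw [h3] at hle
    have h4 : 0 < 1 - ‖g z‖ ^ 2 := by nlinarith [norm_nonneg (g z)]
    have := mul_le_mul_of_nonneg_right hle h4.le
    linear_combination this - (‖deriv g z‖ * (1 - ‖z‖ ^ 2)) * h2
  -- If `|g z| = 1`, then `g` is constant near `z` by the maximum principle.
  · have hloc : IsLocalMax (norm ∘ g) z := by
      filter_upwards [isOpen_ball.mem_nhds hzb] with w hw
      simpa [heq] using hg1 w hw
    have hdiff : ∀ᶠ w in 𝓝 z, DifferentiableAt ℂ g w := by
      filter_upwards [isOpen_ball.mem_nhds hzb] with w hw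
      exact hg.differentiableAt (isOpen_ball.mem_nhds hw)
    have hconst : g =ᶠ[𝓝 z] fun _ ↦ g z := eventually_eq_of_isLocalMax_norm hdiff hloc
    rw [hconst.deriv_eq, deriv_const, heq]
    simp

/-- Dividing by `z ^ m` a bounded holomorphic function on the disc that is `O(z ^ m)` at `0`
preserves the bound `1`: this is the Schwarz lemma applied `m` times. -/
lemma exists_eq_pow_mul {m : ℕ} {h : ℂ → ℂ} (hd : DifferentiableOn ℂ h (ball 0 1))
    (h1 : ∀ z ∈ ball (0 : ℂ) 1, ‖h z‖ ≤ 1) (hO : h =O[𝓝[≠] 0] fun z ↦ z ^ m) :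
    ∃ g : ℂ → ℂ, DifferentiableOn ℂ g (ball 0 1) ∧ (∀ z ∈ ball (0 : ℂ) 1, ‖g z‖ ≤ 1) ∧
      ∀ z, h z = z ^ m * g z := by
  induction m generalizing h with
  | zero => exact ⟨h, hd, h1, by simp⟩
  | succ m ih =>
    have h0 : h 0 = 0 := by
      have hlim : Tendsto (fun z : ℂ ↦ z ^ (m + 1)) (𝓝[≠] 0) (𝓝 0) := by
        have : Tendsto (fun z : ℂ ↦ z ^ (m + 1)) (𝓝 0) (𝓝 (0 ^ (m + 1))) :=
          (continuous_pow (m + 1)).tendsto 0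
        rw [zero_pow m.succ_ne_zero] at this
        exact this.mono_left nhdsWithin_le_nhds
      exact tendsto_nhds_unique ((hd.continuousOn.continuousAt (ball_mem_nhds 0 one_pos)).tendsto
        |>.mono_left nhdsWithin_le_nhds) (hO.trans_tendsto hlim)
    have hfac : ∀ z, h z = z * dslope h 0 z := fun z ↦ by
      have := sub_smul_dslope h 0 z
      simpa [h0] using this.symm
    have hds : DifferentiableOn ℂ (dslope h 0) (ball 0 1) :=
      (differentiableOn_dslope (ball_mem_nhds 0 one_pos)).2 hd
    have hds1 : ∀ z ∈ ball (0 : ℂ) 1, ‖dslope h 0 z‖ ≤ 1 := fun z hz ↦ by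
      simpa using norm_dslope_le_div_of_mapsTo_ball (R₁ := 1) (R₂ := 1) hd
        (fun w hw ↦ by simpa [h0] using h1 w hw) hz
    have hdsO : dslope h 0 =O[𝓝[≠] 0] fun z ↦ z ^ m := by
      obtain ⟨C, hC⟩ := hO.bound
      refine Asymptotics.IsBigO.of_bound C ?_
      filter_upwards [hC, self_mem_nhdsWithin] with z hz hz0
      have hz0' : 0 < ‖z‖ := norm_pos_iff.2 hz0
      rw [hfac, norm_mul, norm_pow, pow_succ'] at hz
      rw [norm_pow]
      exact le_of_mul_le_mul_left (by linarith) hz0'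
    obtain ⟨g, hg, hg1, hgh⟩ := ih hds hds1 hdsO
    exact ⟨g, hg, hg1, fun z ↦ by rw [hfac, hgh, pow_succ']; ring⟩

lemma two_mul_mul_sum_pow_le {r : ℝ} (hr0 : 0 ≤ r) (hr1 : r ≤ 1) (m : ℕ) :
    2 * r * ∑ k ∈ Finset.range m, (r ^ 2) ^ k ≤ m * (1 + r ^ (2 * m)) := by
  have h1 : 2 * r * ∑ k ∈ Finset.range m, (r ^ 2) ^ k =
      ∑ k ∈ Finset.range m, (r ^ (2 * k + 1) + r ^ (2 * (m - 1 - k) + 1)) := by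
    rw [Finset.sum_add_distrib, Finset.sum_range_reflect (fun k ↦ r ^ (2 * k + 1)), ← two_mul,
      mul_assoc, Finset.mul_sum]
    congr 1
    refine Finset.sum_congr rfl fun k _ ↦ ?_
    rw [← pow_mul, pow_succ']
  -- Two powers `x`, `y` of `r` whose exponents add up to `2 m` satisfy `x + y ≤ 1 + x y`.
  rw [h1]
  refine (Finset.sum_le_card_nsmul _ _ (1 + r ^ (2 * m)) fun k hk ↦ ?_).trans_eq (by simp; ring)
  have hk' := Finset.mem_range.1 hk
  have h2 : r ^ (2 * m) = r ^ (2 * k + 1) * r ^ (2 * (m - 1 - k) + 1) := by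
    rw [← pow_add]
    congr 1
    omega
  rw [h2]
  nlinarith [mul_nonneg (sub_nonneg.2 (pow_le_one₀ hr0 hr1 : r ^ (2 * k + 1) ≤ 1))
    (sub_nonneg.2 (pow_le_one₀ hr0 hr1 : r ^ (2 * (m - 1 - k) + 1) ≤ 1))]

/-- The elementary inequality behind `norm_deriv_mul_le_of_isBigO`. It is affine in `s` once the
factor `1 - s` is removed, hence follows from the cases `s = 0` and `s = 1`. -/
lemma add_mul_one_sub_le {m : ℕ} {r s d : ℝ} (hr0 : 0 ≤ r) (hr1 : r < 1)
    (hs0 : 0 ≤ s) (hs1 : s ≤ 1) (hd : d * (1 - r ^ 2) ≤ 1 - s ^ 2) :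
    (m * s + r * d) * (1 - r ^ (2 * m)) ≤ m * (1 - r ^ (2 * m) * s ^ 2) := by
  have hS : (1 - r ^ 2) * ∑ k ∈ Finset.range m, (r ^ 2) ^ k = 1 - r ^ (2 * m) := by
    rw [mul_neg_geom_sum, pow_mul]
  have h1 := two_mul_mul_sum_pow_le hr0 hr1.le m
  set S := ∑ k ∈ Finset.range m, (r ^ 2) ^ k
  set R := r ^ (2 * m)
  have hS0 : 0 ≤ S := by positivity
  have h0 : r * S ≤ m := by
    have hR1 : R ≤ 1 := pow_le_one₀ hr0 hr1.le
    have : (m : ℝ) * (1 + R) ≤ m * 2 := by gcongr; linarith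
    linarith
  have h2 : r * S * (1 + s) ≤ m * (1 + R * s) := by
    nlinarith
  have h3 : r * d * (1 - R) ≤ r * S * (1 - s ^ 2) := by
    rw [← hS]
    have := mul_le_mul_of_nonneg_left hd (mul_nonneg hr0 hS0)
    linarith
  have h4 := mul_le_mul_of_nonneg_left h2 (sub_nonneg.2 hs1)
  nlinarith

/-- If a holomorphic self-map `h` of the disc satisfies `h = h 0 + O(z ^ m)`, its hyperbolic
derivative is at most that of `z ↦ z ^ m`. -/
lemma norm_deriv_mul_le_of_isBigO {m : ℕ} (hm : 1 ≤ m) {h : ℂ → ℂ}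
    (hd : DifferentiableOn ℂ h (ball 0 1)) (h1 : ∀ z ∈ ball (0 : ℂ) 1, ‖h z‖ < 1)
    (hO : (fun z ↦ h z - h 0) =O[𝓝 0] fun z ↦ z ^ m) {z : ℂ} (hz : ‖z‖ < 1) :
    ‖deriv h z‖ * (1 - ‖z‖ ^ (2 * m)) ≤ m * ‖z‖ ^ (m - 1) * (1 - ‖h z‖ ^ 2) := by
  have h0b : (0 : ℂ) ∈ ball (0 : ℂ) 1 := by simp
  have hzb : z ∈ ball (0 : ℂ) 1 := by simpa using hz
  set c := h 0 with hc
  have hc1 : ‖c‖ < 1 := h1 0 h0b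
  set H : ℂ → ℂ := fun z ↦ mobius c (h z) with hH
  have hder : ∀ w ∈ ball (0 : ℂ) 1, HasDerivAt H _ w := fun w hw ↦
    (hasDerivAt_mobius (mobius_den_ne_zero hc1 (h1 w hw).le)).comp w
      (hd.hasDerivAt (isOpen_ball.mem_nhds hw))
  have hHd : DifferentiableOn ℂ H (ball 0 1) :=
    fun w hw ↦ (hder w hw).differentiableAt.differentiableWithinAt
  have hHO : H =O[𝓝 0] fun z ↦ z ^ m := by
    refine Asymptotics.IsBigO.trans ?_ hO
    have hH' : H = fun z ↦ (1 - conj c * h z)⁻¹ * (h z - c) := by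
      funext z
      rw [hH, ← div_eq_inv_mul]
      rfl
    have hcont : ContinuousAt (fun z ↦ (1 - conj c * h z)⁻¹) 0 :=
      ((hd.continuousOn.continuousAt (isOpen_ball.mem_nhds h0b)).const_mul (conj c)
        |>.const_sub 1).inv₀ (mobius_den_ne_zero hc1 hc1.le)
    rw [hH']
    simpa using (hcont.isBigO_one ℂ).mul (Asymptotics.isBigO_refl (fun z ↦ h z - c) (𝓝 0))
  obtain ⟨g, hg, hg1, hgH⟩ := exists_eq_pow_mul hHd
    (fun z hz ↦ (norm_mobius_lt_one hc1 (h1 z hz)).le)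
    (hHO.mono nhdsWithin_le_nhds)
  have hgd := hg.hasDerivAt (isOpen_ball.mem_nhds hzb)
  have hHder : HasDerivAt H (m * z ^ (m - 1) * g z + z ^ m * deriv g z) z := by
    rw [show H = fun z ↦ z ^ m * g z from funext hgH]
    exact (hasDerivAt_pow m z).mul hgd
  have hH1 : ‖m * z ^ (m - 1) * g z + z ^ m * deriv g z‖ * (1 - ‖z‖ ^ (2 * m)) ≤
      m * ‖z‖ ^ (m - 1) * (1 - ‖H z‖ ^ 2) := by
    have h2 := add_mul_one_sub_le (m := m) (norm_nonneg z) hz (norm_nonneg (g z)) (hg1 z hzb)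
      (norm_deriv_mul_le_of_mapsTo_closedBall hg hg1 hz)
    have h3 := mul_le_mul_of_nonneg_left h2 (pow_nonneg (norm_nonneg z) (m - 1))
    have h4 : ‖m * z ^ (m - 1) * g z + z ^ m * deriv g z‖ ≤
        ‖z‖ ^ (m - 1) * (m * ‖g z‖ + ‖z‖ * ‖deriv g z‖) := by
      refine (norm_add_le _ _).trans_eq ?_
      rw [norm_mul, norm_mul, norm_mul, norm_natCast, norm_pow, norm_pow,
        ← mul_pow_sub_one (by omega : m ≠ 0) ‖z‖]
      ring
    have h5 : 0 ≤ 1 - ‖z‖ ^ (2 * m) := sub_nonneg.2 (pow_le_one₀ (norm_nonneg z) hz.le)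
    refine (mul_le_mul_of_nonneg_right h4 h5).trans ?_
    rw [hgH z, norm_mul, norm_pow, mul_pow, ← pow_mul, mul_comm m 2]
    linarith
  rw [hHder.unique (hder z hzb), norm_mul, ← norm_deriv_mobius_mul hc1 (h1 z hzb).le] at hH1
  set D : ℂ := ((1 - ‖c‖ ^ 2 : ℝ) / (1 - conj c * h z) ^ 2 : ℂ) with hD
  have hD0 : 0 < ‖D‖ := by
    refine norm_pos_iff.2 (div_ne_zero (ofReal_ne_zero.2 ?_)
      (pow_ne_zero 2 (mobius_den_ne_zero hc1 (h1 z hzb).le)))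
    nlinarith [norm_nonneg c]
  exact le_of_mul_le_mul_left (by linarith) hD0

/-! ### The parametrization and the Carathéodory distance of the parabola -/

lemma param_mem_parabola {m n : ℕ} (hm : 1 ≤ m) (hn : 1 ≤ n) {z : ℂ} (hz : ‖z‖ < 1) :
    param m n z ∈ parabola m n := by
  refine ⟨?_, ?_, ?_⟩
  · simpa [param] using pow_lt_one₀ (norm_nonneg z) hz (by omega)
  · simpa [param] using pow_lt_one₀ (norm_nonneg z) hz (by omega)
  · simp only [param, ← pow_mul, mul_comm]

lemma exists_param_eq {m n : ℕ} (hcop : Nat.Coprime m n) {x : ℂ × ℂ}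
    (hx : x ∈ parabola m n) : ∃ z : ℂ, ‖z‖ < 1 ∧ param m n z = x := by
  obtain ⟨-, h2, h3⟩ := hx
  obtain ⟨c, hc1, hc2⟩ := (pow_eq_pow_iff_of_coprime hcop).1 h3
  refine ⟨c, ?_, Prod.ext hc1.symm hc2.symm⟩
  rw [hc2, norm_pow] at h2
  by_contra! h
  exact absurd h2 (not_lt.2 (one_le_pow₀ h))

lemma param_injective {m n : ℕ} (hm : 1 ≤ m) (hcop : Nat.Coprime m n) :
    Function.Injective (param m n) := by
  intro a b hab
  obtain ⟨h1, h2⟩ := Prod.ext_iff.1 hab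
  simp only [param] at h1 h2
  rcases eq_or_ne b 0 with rfl | hb
  · rw [zero_pow (by omega : m ≠ 0)] at h2
    exact pow_eq_zero_iff (by omega) |>.1 h2
  have h1' : (a / b) ^ n = 1 := by rw [div_pow, h1, div_self (pow_ne_zero _ hb)]
  have h2' : (a / b) ^ m = 1 := by rw [div_pow, h2, div_self (pow_ne_zero _ hb)]
  have := Nat.eq_one_of_dvd_coprimes hcop (orderOf_dvd_of_pow_eq_one h2')
    (orderOf_dvd_of_pow_eq_one h1')
  exact (div_eq_one_iff_eq hb).1 (orderOf_eq_one_iff.1 this)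

lemma differentiable_param (m n : ℕ) : Differentiable ℂ (param m n) :=
  (differentiable_id.pow n).prodMk (differentiable_id.pow m)

/-- Near the origin `param m n z = O(z ^ m)`, since `m ≤ n`. -/
lemma param_isBigO {m n : ℕ} (hmn : m ≤ n) : param m n =O[𝓝 0] fun z ↦ z ^ m := by
  refine Asymptotics.IsBigO.prod_left ?_ (Asymptotics.isBigO_refl _ _)
  refine Asymptotics.IsBigO.of_bound 1 ?_
  filter_upwards [ball_mem_nhds (0 : ℂ) one_pos] with z hz
  rw [one_mul, norm_pow, norm_pow]
  exact pow_le_pow_of_le_one (norm_nonneg z) (mem_ball_zero_iff.1 hz).le hmn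

section Pullback

variable {m n : ℕ} {f : ℂ × ℂ → ℂ}

lemma differentiableOn_comp_param (hm : 1 ≤ m) (hn : 1 ≤ n)
    (hf : HolomorphicOnVariety (parabola m n) f) :
    DifferentiableOn ℂ (fun z ↦ f (param m n z)) (ball 0 1) := by
  intro z hz
  obtain ⟨U, hU, hzU, F, hF, hfF⟩ := hf _ (param_mem_parabola hm hn (mem_ball_zero_iff.1 hz))
  have h1 : DifferentiableAt ℂ (fun z ↦ F (param m n z)) z :=
    (hF.differentiableAt (hU.mem_nhds hzU)).comp z (differentiable_param m n z)
  refine (h1.congr_of_eventuallyEq ?_).differentiableWithinAt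
  filter_upwards [(differentiable_param m n).continuous.continuousAt.preimage_mem_nhds
    (hU.mem_nhds hzU), isOpen_ball.mem_nhds hz] with w hw hw1
  exact hfF _ ⟨hw, param_mem_parabola hm hn (mem_ball_zero_iff.1 hw1)⟩

/-- The Taylor expansion of `f ∘ param m n` has no terms of order `1, …, m - 1`. -/
lemma comp_param_sub_isBigO (hm : 1 ≤ m) (hmn : m ≤ n)
    (hf : HolomorphicOnVariety (parabola m n) f) :
    (fun z ↦ f (param m n z) - f (param m n 0)) =O[𝓝 0] fun z ↦ z ^ m := by
  have h0A := param_mem_parabola hm (hm.trans hmn) (z := 0) (by simp)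
  obtain ⟨U, hU, h0U, F, hF, hfF⟩ := hf _ h0A
  have hcont := (differentiable_param m n).continuous.tendsto 0
  have h1 := (hF.differentiableAt (hU.mem_nhds h0U)).isBigO_sub.comp_tendsto hcont
  have h2 : param m n 0 = 0 := by
    simp [param, zero_pow (by omega : m ≠ 0), zero_pow (by omega : n ≠ 0)]
  refine Asymptotics.IsBigO.trans ?_ (param_isBigO hmn)
  refine h1.congr' ?_ (by simp [h2, Function.comp_def])
  filter_upwards [hcont.eventually (hU.mem_nhds h0U), ball_mem_nhds (0 : ℂ) one_pos] with w hw hw1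
  rw [hfF _ ⟨h0U, h0A⟩, hfF _ ⟨hw, param_mem_parabola hm (hm.trans hmn) (mem_ball_zero_iff.1 hw1)⟩]
  rfl

lemma norm_deriv_comp_param_mul_le (hm : 1 ≤ m) (hmn : m ≤ n)
    (hf : HolomorphicOnVariety (parabola m n) f) (hf1 : ∀ x ∈ parabola m n, ‖f x‖ < 1)
    {z : ℂ} (hz : ‖z‖ < 1) :
    ‖deriv (fun z ↦ f (param m n z)) z‖ * (1 - ‖z‖ ^ (2 * m)) ≤
      m * ‖z‖ ^ (m - 1) * (1 - ‖f (param m n z)‖ ^ 2) :=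
  norm_deriv_mul_le_of_isBigO hm (differentiableOn_comp_param hm (hm.trans hmn) hf)
    (fun _ hw ↦ hf1 _ (param_mem_parabola hm (hm.trans hmn) (mem_ball_zero_iff.1 hw)))
    (comp_param_sub_isBigO hm hmn hf) hz

/-- The Schwarz–Pick lemma for `f ∘ param m n`; it bounds the supremum in `caratheodoryMobius`
away from `1`, so that `artanh` is not evaluated at a junk value. -/
lemma mobiusDist_comp_param_le (hm : 1 ≤ m) (hn : 1 ≤ n)
    (hf : HolomorphicOnVariety (parabola m n) f) (hf1 : ∀ x ∈ parabola m n, ‖f x‖ < 1)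
    {a b : ℂ} (ha : ‖a‖ < 1) (hb : ‖b‖ < 1) :
    mobiusDist (f (param m n a)) (f (param m n b)) ≤ mobiusDist a b := by
  have hnb : ‖-b‖ < 1 := by rwa [norm_neg]
  have hp := fun {z : ℂ} (hz : ‖z‖ < 1) ↦ hf1 _ (param_mem_parabola hm hn hz)
  have hmaps : ∀ u ∈ ball (0 : ℂ) 1, ‖mobius (-b) u‖ < 1 := fun u hu ↦
    norm_mobius_lt_one hnb (mem_ball_zero_iff.1 hu)
  set F : ℂ → ℂ := fun u ↦ mobius (f (param m n b)) (f (param m n (mobius (-b) u))) with hF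
  have hd : DifferentiableOn ℂ F (ball 0 1) := fun u hu ↦ by
    have h1 := (differentiableOn_comp_param hm hn hf).differentiableAt
      (isOpen_ball.mem_nhds (mem_ball_zero_iff.2 (hmaps u hu)))
    have h2 := (hasDerivAt_mobius (mobius_den_ne_zero hnb (mem_ball_zero_iff.1 hu).le))
    have h3 := (hasDerivAt_mobius (mobius_den_ne_zero (hp hb) (hp (hmaps u hu)).le))
    exact (DifferentiableAt.comp (g := mobius (f (param m n b))) u h3.differentiableAt
      (DifferentiableAt.comp (g := fun z ↦ f (param m n z)) u h1
        h2.differentiableAt)).differentiableWithinAt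
  have h0 : mobius (-b) 0 = b := by simp [mobius]
  have := norm_le_norm_of_mapsTo_ball (f := F) (z := mobius b a) hd
    (fun u hu ↦ mem_closedBall_zero_iff.2 (norm_mobius_lt_one (hp hb) (hp (hmaps u hu))).le)
    (by simp [hF, h0]) (norm_mobius_lt_one hb ha)
  simp only [hF] at this
  rwa [mobius_neg_mobius hb ha, ← mobiusDist_eq, ← mobiusDist_eq] at this

lemma mobiusDist_mem_upperBounds (hm : 1 ≤ m) (hn : 1 ≤ n) {a b : ℂ} (ha : ‖a‖ < 1) (hb : ‖b‖ < 1) :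
    mobiusDist a b ∈ upperBounds {r : ℝ | ∃ f : ℂ × ℂ → ℂ,
      HolomorphicOnVariety (parabola m n) f ∧ (∀ z ∈ parabola m n, ‖f z‖ < 1) ∧
        r = mobiusDist (f (param m n a)) (f (param m n b))} := by
  rintro r ⟨f, hf, hf1, rfl⟩
  exact mobiusDist_comp_param_le hm hn hf hf1 ha hb

lemma caratheodoryMobius_mem (hm : 1 ≤ m) (hn : 1 ≤ n) {a b : ℂ} (ha : ‖a‖ < 1) (hb : ‖b‖ < 1) :
    caratheodoryMobius (parabola m n) (param m n a) (param m n b) ∈ Ico (0 : ℝ) 1 := by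
  have hmem : (0 : ℝ) ∈ {r : ℝ | ∃ f : ℂ × ℂ → ℂ,
      HolomorphicOnVariety (parabola m n) f ∧ (∀ z ∈ parabola m n, ‖f z‖ < 1) ∧
        r = mobiusDist (f (param m n a)) (f (param m n b))} :=
    ⟨fun _ ↦ 0, fun x _ ↦ ⟨univ, isOpen_univ, mem_univ x, fun _ ↦ 0,
      differentiableOn_const 0, fun _ _ ↦ rfl⟩, by simp, by simp⟩
  have hb' := mobiusDist_mem_upperBounds hm hn ha hb
  exact ⟨le_csSup ⟨_, hb'⟩ hmem, (csSup_le ⟨0, hmem⟩ hb').trans_lt (mobiusDist_lt_one ha hb)⟩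

lemma poincareDist_le_caratheodoryDist (hm : 1 ≤ m) (hn : 1 ≤ n)
    (hf : HolomorphicOnVariety (parabola m n) f) (hf1 : ∀ x ∈ parabola m n, ‖f x‖ < 1)
    {a b : ℂ} (ha : ‖a‖ < 1) (hb : ‖b‖ < 1) :
    poincareDist (f (param m n a)) (f (param m n b)) ≤
      caratheodoryDist (parabola m n) (param m n a) (param m n b) := by
  rw [poincareDist_eq_artanh (hf1 _ (param_mem_parabola hm hn ha))
    (hf1 _ (param_mem_parabola hm hn hb)), caratheodoryDist]
  refine Real.artanh_le_artanh ?_ (caratheodoryMobius_mem hm hn ha hb).2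
    (le_csSup ⟨_, mobiusDist_mem_upperBounds hm hn ha hb⟩ ⟨f, hf, hf1, rfl⟩)
  linarith [mobiusDist_nonneg (f (param m n a)) (f (param m n b))]

lemma caratheodoryDist_le (hm : 1 ≤ m) (hn : 1 ≤ n) {a b : ℂ} (ha : ‖a‖ < 1) (hb : ‖b‖ < 1)
    {R : ℝ} (hR : ∀ f : ℂ × ℂ → ℂ, HolomorphicOnVariety (parabola m n) f →
      (∀ x ∈ parabola m n, ‖f x‖ < 1) →
        poincareDist (f (param m n a)) (f (param m n b)) ≤ R) :
    caratheodoryDist (parabola m n) (param m n a) (param m n b) ≤ R := by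
  rw [caratheodoryDist, ← Real.artanh_tanh R]
  refine Real.artanh_le_artanh (by linarith [(caratheodoryMobius_mem hm hn ha hb).1])
    (Real.tanh_lt_one R) (csSup_le ?_ ?_)
  · exact ⟨_, fun _ ↦ 0, fun x _ ↦ ⟨univ, isOpen_univ, mem_univ x, fun _ ↦ 0,
      differentiableOn_const 0, fun _ _ ↦ rfl⟩, by simp, rfl⟩
  · rintro r ⟨f, hf, hf1, rfl⟩
    have ha' := hf1 _ (param_mem_parabola hm hn ha)
    have hb' := hf1 _ (param_mem_parabola hm hn hb)
    have h := hR f hf hf1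
    rw [poincareDist_eq_artanh ha' hb', ← Real.artanh_tanh R] at h
    exact (Real.artanh_le_artanh_iff
      ⟨by linarith [mobiusDist_nonneg (f (param m n a)) (f (param m n b))],
        mobiusDist_lt_one ha' hb'⟩ ⟨Real.neg_one_lt_tanh R, Real.tanh_lt_one R⟩).1 h

/-- The second coordinate is a competitor in the definition of the Carathéodory distance. -/
lemma poincareDist_pow_le_caratheodoryDist (hm : 1 ≤ m) (hn : 1 ≤ n) {a b : ℂ} (ha : ‖a‖ < 1)
    (hb : ‖b‖ < 1) :
    poincareDist (a ^ m) (b ^ m) ≤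
      caratheodoryDist (parabola m n) (param m n a) (param m n b) :=
  poincareDist_le_caratheodoryDist (f := Prod.snd) hm hn
    (fun x _ ↦ ⟨univ, isOpen_univ, mem_univ x, Prod.snd, differentiableOn_snd, fun _ _ ↦ rfl⟩)
    (fun _ hx ↦ hx.2.1) ha hb

end Pullback

/-! ### Lengths of curves -/

/-- The upper bound for the inner distance given by the curve `param m n ∘ ℓ`, where the
nondecreasing potential `T` controls the displacement along the curve. -/
lemma innerCaratheodoryDist_le {m n : ℕ} (hm : 1 ≤ m) (hn : 1 ≤ n) {l : ℝ → ℂ} {T : ℝ → ℝ}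
    {K : NNReal} (hl : LipschitzOnWith K l (Icc 0 1)) (hl1 : ∀ t ∈ Icc (0 : ℝ) 1, ‖l t‖ < 1)
    (hT : ∀ f : ℂ × ℂ → ℂ, HolomorphicOnVariety (parabola m n) f →
      (∀ x ∈ parabola m n, ‖f x‖ < 1) → ∀ s ∈ Icc (0 : ℝ) 1, ∀ t ∈ Icc (0 : ℝ) 1, s ≤ t →
        poincareDist (f (param m n (l s))) (f (param m n (l t))) ≤ T t - T s) :
    innerCaratheodoryDist (parabola m n) (param m n (l 0)) (param m n (l 1)) ≤
      ENNReal.ofReal (T 1 - T 0) := by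
  have hmono : ∀ s ∈ Icc (0 : ℝ) 1, ∀ t ∈ Icc (0 : ℝ) 1, s ≤ t → T s ≤ T t := by
    intro s hs t ht hst
    have h := hT (fun _ ↦ 0) (fun x _ ↦ ⟨univ, isOpen_univ, mem_univ x, fun _ ↦ 0,
      differentiableOn_const 0, fun _ _ ↦ rfl⟩) (by simp) s hs t ht hst
    have h0 := poincareDist_nonneg (a := 0) (b := 0) (by simp) (by simp)
    linarith
  have hbv : BoundedVariationOn (param m n ∘ l) (Icc 0 1) := by
    obtain ⟨C, hC⟩ := ((contDiff_id.pow n).prodMk (contDiff_id.pow m) :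
      ContDiff ℝ 1 (param m n)).contDiffOn.exists_lipschitzOnWith one_ne_zero
        (convex_closedBall (0 : ℂ) 1) (isCompact_closedBall 0 1)
    have h1 : BoundedVariationOn l (Icc 0 1) := by
      have hid : BoundedVariationOn (id : ℝ → ℝ) (Icc 0 1) := by
        have := (monotone_id.monotoneOn (Icc (0 : ℝ) 1)).locallyBoundedVariationOn 0 1
          (by simp) (by simp)
        rwa [inter_self] at this
      exact hl.comp_boundedVariationOn (mapsTo_id _) hid
    exact hC.comp_boundedVariationOn (fun t ht ↦ mem_closedBall_zero_iff.2 (hl1 t ht).le) h1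
  have hcurve : IsRectifiableCurve (parabola m n) (param m n (l 0)) (param m n (l 1))
      (param m n ∘ l) :=
    { continuousOn := (differentiable_param m n).continuous.comp_continuousOn hl.continuousOn
      boundedVariation := hbv
      mem := fun t ht ↦ param_mem_parabola hm hn (hl1 t ht)
      source := rfl
      target := rfl }
  refine (iInf₂_le _ hcurve).trans (iSup_le ?_)
  rintro ⟨k, u, hu, huI⟩
  have hle : ∀ i, caratheodoryDist (parabola m n) (param m n (l (u i)))
      (param m n (l (u (i + 1)))) ≤ T (u (i + 1)) - T (u i) := fun i ↦
    caratheodoryDist_le hm hn (hl1 _ (huI i)) (hl1 _ (huI (i + 1))) fun f hf hf1 ↦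
      hT f hf hf1 _ (huI i) _ (huI (i + 1)) (hu (Nat.le_succ i))
  calc ∑ i ∈ Finset.range k, ENNReal.ofReal (caratheodoryDist (parabola m n)
          (param m n (l (u i))) (param m n (l (u (i + 1)))))
      ≤ ∑ i ∈ Finset.range k, ENNReal.ofReal (T (u (i + 1)) - T (u i)) :=
        Finset.sum_le_sum fun i _ ↦ ENNReal.ofReal_le_ofReal (hle i)
    _ = ENNReal.ofReal (∑ i ∈ Finset.range k, (T (u (i + 1)) - T (u i))) :=
        (ENNReal.ofReal_sum_of_nonneg fun i _ ↦ sub_nonneg.2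
          (hmono _ (huI i) _ (huI (i + 1)) (hu (Nat.le_succ i)))).symm
    _ ≤ ENNReal.ofReal (T 1 - T 0) := by
        rw [Finset.sum_range_sub (fun i ↦ T (u i))]
        refine ENNReal.ofReal_le_ofReal (sub_le_sub ?_ ?_)
        · exact hmono _ (huI k) _ (by simp) (huI k).2
        · exact hmono _ (by simp) _ (huI 0) (huI 0).1

/-- A curve in the parabola lifts to a curve in the disc, because `param m n` restricts to a
homeomorphism from the compact closed disc onto its image. -/
lemma exists_continuousOn_lift {m n : ℕ} (hm : 1 ≤ m) (hcop : Nat.Coprime m n) {α : ℝ → ℂ × ℂ}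
    (hα : ContinuousOn α (Icc 0 1)) (hmem : ∀ t ∈ Icc (0 : ℝ) 1, α t ∈ parabola m n) :
    ∃ l : ℝ → ℂ, ContinuousOn l (Icc 0 1) ∧
      ∀ t ∈ Icc (0 : ℝ) 1, ‖l t‖ < 1 ∧ param m n (l t) = α t := by
  choose! l hl using fun t (ht : t ∈ Icc (0 : ℝ) 1) ↦ exists_param_eq hcop (hmem t ht)
  refine ⟨l, ?_, hl⟩
  let q : closedBall (0 : ℂ) 1 → ℂ × ℂ := fun z ↦ param m n z
  have hq : IsClosedEmbedding q :=
    Continuous.isClosedEmbedding ((differentiable_param m n).continuous.comp continuous_subtype_val)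
      fun a b hab ↦ Subtype.ext (param_injective hm hcop hab)
  let L : Icc (0 : ℝ) 1 → closedBall (0 : ℂ) 1 :=
    fun t ↦ ⟨l t, mem_closedBall_zero_iff.2 (hl t t.2).1.le⟩
  have hL : Continuous L := by
    rw [hq.isInducing.continuous_iff]
    have : q ∘ L = (Icc (0 : ℝ) 1).domRestrict α := funext fun t ↦ (hl t t.2).2
    rw [this]
    exact hα.domRestrict
  exact continuousOn_iff_continuous_domRestrict.2 (continuous_subtype_val.comp hL)

lemma add_le_curveLength {X : Type*} (d : X → X → ℝ) (α : ℝ → X) {t : ℝ}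
    (ht : t ∈ Icc (0 : ℝ) 1) :
    ENNReal.ofReal (d (α 0) (α t)) + ENNReal.ofReal (d (α t) (α 1)) ≤ curveLength d α := by
  let u : ℕ → ℝ := fun i ↦ if i = 0 then 0 else if i = 1 then t else 1
  have hu : Monotone u := monotone_nat_of_le_succ fun i ↦ by
    rcases i with _ | _ | i
    · simpa [u] using ht.1
    · simpa [u] using ht.2
    · simp [u]
  have hI : ∀ i, u i ∈ Icc (0 : ℝ) 1 := fun i ↦ by
    rcases i with _ | _ | i
    · simp [u]
    · simpa [u] using ht
    · simp [u]
  refine le_trans ?_ (le_iSup _ (⟨2, u, hu, hI⟩ : ℕ × {u : ℕ → ℝ // Monotone u ∧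
    ∀ i, u i ∈ Set.Icc (0 : ℝ) 1}))
  simp [u, Finset.sum_range_succ]

/-! ### The lower bound -/

/-- A number of argument `± π / m` has a nonpositive `m`-th power. -/
lemma pow_eq_neg_of_re_eq {m : ℕ} (hm : 1 ≤ m) {z : ℂ} (hz : z.re = Real.cos (Real.pi / m) * ‖z‖) :
    z ^ m = -(‖z‖ ^ m : ℝ) := by
  have hm0 : (m : ℂ) ≠ 0 := by exact_mod_cast (by omega : m ≠ 0)
  have him : z.im ^ 2 = (Real.sin (Real.pi / m) * ‖z‖) ^ 2 := by
    have h1 := normSq_apply z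
    rw [normSq_eq_norm_sq] at h1
    have h2 := Real.sin_sq_add_cos_sq (Real.pi / m)
    rw [hz] at h1
    linear_combination -h1 - ‖z‖ ^ 2 * h2
  have key : ∀ θ : ℝ, (θ = Real.pi / m ∨ θ = -(Real.pi / m)) →
      z.im = Real.sin θ * ‖z‖ → z ^ m = -(‖z‖ ^ m : ℝ) := by
    intro θ hθ hsin
    have h : z = ‖z‖ * exp (θ * I) := by
      apply Complex.ext
      · rw [re_ofReal_mul, exp_ofReal_mul_I_re, hz, mul_comm]
        rcases hθ with rfl | rfl
        · rfl
        · rw [Real.cos_neg]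
      · rw [im_ofReal_mul, exp_ofReal_mul_I_im, hsin, mul_comm]
    have h1 : exp (θ * I) ^ m = -1 := by
      rw [← Complex.exp_nat_mul, ← mul_assoc]
      rcases hθ with rfl | rfl
      · have : (m : ℂ) * ((Real.pi / m : ℝ) : ℂ) = Real.pi := by
          push_cast
          field_simp
        rw [this, exp_pi_mul_I]
      · have : (m : ℂ) * ((-(Real.pi / m) : ℝ) : ℂ) = -Real.pi := by
          push_cast
          field_simp
        rw [this, neg_mul, Complex.exp_neg, exp_pi_mul_I]
        norm_num
    conv_lhs => rw [h, mul_pow, h1]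
    push_cast
    ring
  rcases sq_eq_sq_iff_eq_or_eq_neg.1 him with h | h
  · exact key _ (Or.inl rfl) h
  · exact key _ (Or.inr rfl) (by rw [h, Real.sin_neg, neg_mul])

lemma norm_pow_lt_one {m : ℕ} (hm : 1 ≤ m) {z : ℂ} (hz : ‖z‖ < 1) : ‖z ^ m‖ < 1 := by
  rw [norm_pow]
  exact pow_lt_one₀ (norm_nonneg z) hz (by omega)

lemma poincareDist_pow_eq_add {m : ℕ} (hm : 1 ≤ m) {a b : ℂ} (ha : ‖a‖ < 1) (hb : ‖b‖ < 1)
    (h : (a * conj b).re = Real.cos (Real.pi / m) * ‖a * b‖) :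
    poincareDist (a ^ m) (b ^ m) = poincareDist (a ^ m) 0 + poincareDist 0 (b ^ m) := by
  have hn : ‖a * b‖ = ‖a * conj b‖ := by rw [norm_mul, norm_mul, norm_conj]
  rw [hn] at h
  refine poincareDist_eq_add_of_opposite (norm_pow_lt_one hm ha) (norm_pow_lt_one hm hb) ?_
  rw [map_pow, ← mul_pow, pow_eq_neg_of_re_eq hm h, ← hn, norm_mul, mul_pow, norm_pow, norm_pow]

/-- The lower bound for the length of a curve. A curve that turns by more than the angle `π / m`
has a point at which it has turned by exactly this angle, or which is the origin. The `m`-th power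
of that point is opposite to the `m`-th power of the starting point. -/
lemma le_curveLength {m n : ℕ} (hm : 1 ≤ m) (hmn : m ≤ n) (hcop : Nat.Coprime m n)
    {a b : ℂ} (ha : ‖a‖ < 1) (hb : ‖b‖ < 1) {α : ℝ → ℂ × ℂ}
    (hα : IsRectifiableCurve (parabola m n) (param m n a) (param m n b) α) :
    ENNReal.ofReal (if (a * conj b).re ≥ Real.cos (Real.pi / m) * ‖a * b‖ then
        poincareDist (a ^ m) (b ^ m)
      else poincareDist (a ^ m) 0 + poincareDist 0 (b ^ m)) ≤
      curveLength (caratheodoryDist (parabola m n)) α := by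
  have hn : 1 ≤ n := hm.trans hmn
  have hzero : ‖(0 : ℂ)‖ < 1 := by simp
  have h0 : (0 : ℝ) ∈ Icc (0 : ℝ) 1 := by simp
  have h1 : (1 : ℝ) ∈ Icc (0 : ℝ) 1 := by simp
  split_ifs with h
  · refine le_trans ?_ (add_le_curveLength _ α h1)
    rw [hα.source, hα.target]
    exact le_add_right (ENNReal.ofReal_le_ofReal (poincareDist_pow_le_caratheodoryDist hm hn ha hb))
  · push Not at h
    obtain ⟨l, hl, hlα⟩ := exists_continuousOn_lift hm hcop hα.continuousOn hα.mem
    have hl0 : l 0 = a := param_injective hm hcop ((hlα 0 h0).2.trans hα.source)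
    have hl1 : l 1 = b := param_injective hm hcop ((hlα 1 h1).2.trans hα.target)
    let φ : ℝ → ℝ := fun t ↦ (a * conj (l t)).re - Real.cos (Real.pi / m) * ‖a * l t‖
    have hφ : ContinuousOn φ (Icc 0 1) := by
      have hc : ContinuousOn (fun t ↦ conj (l t)) (Icc 0 1) := continuous_conj.comp_continuousOn hl
      exact (continuous_re.comp_continuousOn (continuousOn_const.mul hc)).sub
        (continuousOn_const.mul (continuousOn_const.mul hl).norm)
    have hφ0 : 0 ≤ φ 0 := by
      simp only [φ, hl0, mul_conj, ofReal_re, norm_mul, normSq_eq_norm_sq]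
      nlinarith [Real.cos_le_one (Real.pi / m), sq_nonneg ‖a‖]
    have hφ1 : φ 1 ≤ 0 := by
      simp only [φ, hl1]
      linarith
    obtain ⟨t, ht, hφt⟩ := intermediate_value_Icc' zero_le_one hφ ⟨hφ1, hφ0⟩
    obtain ⟨hlt, hlt'⟩ := hlα t ht
    have hadd := poincareDist_pow_eq_add hm ha hlt (sub_eq_zero.1 hφt)
    have htri := poincareDist_triangle hzero (norm_pow_lt_one hm hlt) (norm_pow_lt_one hm hb)
    refine le_trans ?_ (add_le_curveLength _ α ht)
    rw [hα.source, hα.target, ← hlt']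
    have hd1 := poincareDist_pow_le_caratheodoryDist hm hn ha hlt
    have hd2 := poincareDist_pow_le_caratheodoryDist hm hn hlt hb
    have hd3 := poincareDist_nonneg (norm_pow_lt_one hm ha) (norm_pow_lt_one hm hlt)
    have hd4 := poincareDist_nonneg (norm_pow_lt_one hm hlt) (norm_pow_lt_one hm hb)
    rw [← ENNReal.ofReal_add (hd3.trans hd1) (hd4.trans hd2)]
    exact ENNReal.ofReal_le_ofReal (by linarith)

/-! ### Curves through the origin -/

lemma poincareDist_radial_le {m n : ℕ} (hm : 1 ≤ m) (hmn : m ≤ n) {f : ℂ × ℂ → ℂ}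
    (hf : HolomorphicOnVariety (parabola m n) f) (hf1 : ∀ x ∈ parabola m n, ‖f x‖ < 1)
    {a : ℂ} (ha : ‖a‖ < 1) {s t : ℝ} (hs : 0 ≤ s) (hst : s ≤ t) (ht : t ≤ 1) :
    poincareDist (f (param m n (s * a))) (f (param m n (t * a))) ≤
      Real.artanh ((t * ‖a‖) ^ m) - Real.artanh ((s * ‖a‖) ^ m) := by
  have hnorm : ∀ x ∈ Icc s t, ‖(x : ℂ) * a‖ = x * ‖a‖ := fun x hx ↦ by
    rw [norm_mul, norm_real, Real.norm_of_nonneg (hs.trans hx.1)]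
  have hlt : ∀ x ∈ Icc s t, x * ‖a‖ < 1 := fun x hx ↦
    (mul_le_of_le_one_left (norm_nonneg a) (hx.2.trans ht)).trans_lt ha
  have hlt' : ∀ x ∈ Icc s t, ‖(x : ℂ) * a‖ < 1 := fun x hx ↦ by
    rw [hnorm x hx]
    exact hlt x hx
  have hpow : ∀ x ∈ Icc s t, (x * ‖a‖) ^ m < 1 := fun x hx ↦
    pow_lt_one₀ (mul_nonneg (hs.trans hx.1) (norm_nonneg a)) (hlt x hx) (by omega)
  refine poincareDist_le_of_speed_le (k := fun x : ℝ ↦ f (param m n (x * a)))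
    (k' := fun x ↦ deriv (fun z ↦ f (param m n z)) (x * a) * a)
    (T := fun x ↦ Real.artanh ((x * ‖a‖) ^ m))
    (T' := fun x ↦ 1 / (1 - ((x * ‖a‖) ^ m) ^ 2) * (m * (x * ‖a‖) ^ (m - 1) * ‖a‖)) hst
    (fun x hx ↦ hf1 _ (param_mem_parabola hm (hm.trans hmn) (hlt' x hx))) ?_ ?_ ?_
  · intro x hx
    have h1 := (differentiableOn_comp_param hm (hm.trans hmn) hf).hasDerivAt
      (isOpen_ball.mem_nhds (mem_ball_zero_iff.2 (hlt' x hx)))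
    have h2 : HasDerivAt (fun z : ℂ ↦ z * a) a x := by
      simpa using (hasDerivAt_id (x : ℂ)).mul_const a
    exact (HasDerivAt.comp (h₂ := fun z ↦ f (param m n z)) (x : ℂ) h1 h2).comp_ofReal
  · intro x hx
    have h2 : HasDerivAt (fun y : ℝ ↦ (y * ‖a‖) ^ m) (m * (x * ‖a‖) ^ (m - 1) * ‖a‖) x := by
      have h1 : HasDerivAt (fun y : ℝ ↦ y * ‖a‖) ‖a‖ x := by
        simpa using (hasDerivAt_id x).mul_const ‖a‖
      exact h1.pow m
    refine HasDerivAt.comp (h₂ := Real.artanh) x (hasDerivAt_artanh ?_) h2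
    rw [abs_of_nonneg (pow_nonneg (mul_nonneg (hs.trans hx.1) (norm_nonneg a)) m)]
    exact hpow x hx
  · intro x hx
    have h1 := norm_deriv_comp_param_mul_le hm hmn hf hf1 (hlt' x hx)
    rw [hnorm x hx] at h1
    have h0 : 0 ≤ (x * ‖a‖) ^ m := pow_nonneg (mul_nonneg (hs.trans hx.1) (norm_nonneg a)) m
    have h2 : 0 < 1 - ((x * ‖a‖) ^ m) ^ 2 := by nlinarith [hpow x hx]
    have h3 : (x * ‖a‖) ^ (2 * m) = ((x * ‖a‖) ^ m) ^ 2 := by rw [← pow_mul, mul_comm m 2]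
    rw [h3] at h1
    rw [norm_mul, one_div_mul_eq_div, mul_div_assoc', le_div_iff₀ h2]
    have := mul_le_mul_of_nonneg_right h1 (norm_nonneg a)
    linarith

lemma poincareDist_pow_zero {m : ℕ} (hm : 1 ≤ m) {a : ℂ} (ha : ‖a‖ < 1) :
    poincareDist (a ^ m) 0 = Real.artanh (‖a‖ ^ m) := by
  rw [poincareDist_eq_artanh (norm_pow_lt_one hm ha) (by simp), mobiusDist_zero_right, norm_pow]

/-- The upper bound given by the two radial segments through the origin. -/
lemma innerCaratheodoryDist_le_add {m n : ℕ} (hm : 1 ≤ m) (hmn : m ≤ n)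
    {a b : ℂ} (ha : ‖a‖ < 1) (hb : ‖b‖ < 1) :
    innerCaratheodoryDist (parabola m n) (param m n a) (param m n b) ≤
      ENNReal.ofReal (poincareDist (a ^ m) 0 + poincareDist 0 (b ^ m)) := by
  have hn : 1 ≤ n := hm.trans hmn
  have hm0 : m ≠ 0 := by omega
  let l : ℝ → ℂ := fun t ↦ (max (1 - 2 * t) 0 : ℝ) * a + (max (2 * t - 1) 0 : ℝ) * b
  -- `T t` is the signed distance from the origin along the curve.
  let T : ℝ → ℝ := fun t ↦ Real.artanh ((max (2 * t - 1) 0 * ‖b‖) ^ m) -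
    Real.artanh ((max (1 - 2 * t) 0 * ‖a‖) ^ m)
  have hleft : ∀ t ≤ (1 / 2 : ℝ), l t = (1 - 2 * t : ℝ) * a ∧
      T t = -Real.artanh (((1 - 2 * t) * ‖a‖) ^ m) := by
    intro t ht
    simp only [l, T]
    rw [max_eq_left (by linarith : 0 ≤ 1 - 2 * t), max_eq_right (by linarith : 2 * t - 1 ≤ 0)]
    simp [hm0]
  have hright : ∀ t, (1 / 2 : ℝ) ≤ t → l t = (2 * t - 1 : ℝ) * b ∧
      T t = Real.artanh (((2 * t - 1) * ‖b‖) ^ m) := by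
    intro t ht
    simp only [l, T]
    rw [max_eq_right (by linarith : 1 - 2 * t ≤ 0), max_eq_left (by linarith : 0 ≤ 2 * t - 1)]
    simp [hm0]
  have hlip : ∃ K, LipschitzOnWith K l (Icc 0 1) := by
    have h1 : LipschitzWith 2 fun t : ℝ ↦ 2 * t - 1 := LipschitzWith.of_dist_le_mul fun x y ↦ by
      rw [Real.dist_eq, Real.dist_eq, NNReal.coe_ofNat, ← abs_two, ← abs_mul, abs_two]
      exact le_of_eq (by ring_nf)
    have h2 : LipschitzWith 2 fun t : ℝ ↦ 1 - 2 * t := LipschitzWith.of_dist_le_mul fun x y ↦ by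
      rw [Real.dist_eq, Real.dist_eq, NNReal.coe_ofNat, abs_sub_comm x y, ← abs_two, ← abs_mul,
        abs_two]
      exact le_of_eq (by ring_nf)
    have h3 (c : ℂ) : LipschitzWith ‖c‖₊ fun r : ℝ ↦ (r : ℂ) * c :=
      LipschitzWith.of_dist_le_mul fun x y ↦ by
        rw [dist_eq_norm, ← sub_mul, ← ofReal_sub, norm_mul, norm_real, ← dist_eq_norm, mul_comm]
        rfl
    exact ⟨_, (((h3 a).comp (h2.max_const 0)).add ((h3 b).comp (h1.max_const 0))).lipschitzOnWith⟩
  obtain ⟨K, hK⟩ := hlip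
  have hscale : ∀ (r : ℝ) (c : ℂ), ‖c‖ < 1 → 0 ≤ r → r ≤ 1 → ‖(r : ℂ) * c‖ < 1 := by
    intro r c hc hr0 hr1
    rw [norm_mul, norm_real, Real.norm_of_nonneg hr0]
    exact (mul_le_of_le_one_left (norm_nonneg c) hr1).trans_lt hc
  have hl1 : ∀ t ∈ Icc (0 : ℝ) 1, ‖l t‖ < 1 := by
    intro t ht
    rcases le_total t (1 / 2) with h | h
    · rw [(hleft t h).1]
      exact hscale _ a ha (by linarith) (by linarith [ht.1])
    · rw [(hright t h).1]
      exact hscale _ b hb (by linarith) (by linarith [ht.2])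
  have hhalf : l (1 / 2) = 0 := by rw [(hleft _ le_rfl).1]; norm_num
  have h := innerCaratheodoryDist_le hm hn hK hl1 (T := T) ?_
  · have e0 : l 0 = a := by rw [(hleft 0 (by norm_num)).1]; simp
    have e1 : l 1 = b := by rw [(hright 1 (by norm_num)).1]; norm_num
    have t0 : T 0 = -poincareDist (a ^ m) 0 := by
      rw [(hleft 0 (by norm_num)).2, poincareDist_pow_zero hm ha]
      simp
    have t1 : T 1 = poincareDist 0 (b ^ m) := by
      rw [(hright 1 (by norm_num)).2, poincareDist_comm, poincareDist_pow_zero hm hb]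
      norm_num
    rwa [e0, e1, t0, t1, sub_neg_eq_add, add_comm] at h
  · intro f hf hf1
    have hA : ∀ s t, 0 ≤ s → s ≤ t → t ≤ 1 / 2 →
        poincareDist (f (param m n (l s))) (f (param m n (l t))) ≤ T t - T s := by
      intro s t hs hst ht
      have h1 := poincareDist_radial_le hm hmn hf hf1 ha (s := 1 - 2 * t) (t := 1 - 2 * s)
        (by linarith) (by linarith) (by linarith)
      rw [poincareDist_comm, (hleft s (hst.trans ht)).1, (hleft s (hst.trans ht)).2,
        (hleft t ht).1, (hleft t ht).2]
      linarith
    have hB : ∀ s t, 1 / 2 ≤ s → s ≤ t → t ≤ 1 →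
        poincareDist (f (param m n (l s))) (f (param m n (l t))) ≤ T t - T s := by
      intro s t hs hst ht
      have h1 := poincareDist_radial_le hm hmn hf hf1 hb (s := 2 * s - 1) (t := 2 * t - 1)
        (by linarith) (by linarith) (by linarith)
      rw [(hright s hs).1, (hright s hs).2, (hright t (hs.trans hst)).1,
        (hright t (hs.trans hst)).2]
      exact h1
    intro s hs t ht hst
    rcases le_total t (1 / 2) with h | h
    · exact hA s t hs.1 hst h
    rcases le_total (1 / 2) s with h' | h'
    · exact hB s t h' hst ht.2
    · have hp := fun x (hx : x ∈ Icc (0 : ℝ) 1) ↦ hf1 _ (param_mem_parabola hm hn (hl1 x hx))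
      have := poincareDist_triangle (hp s hs) (hp (1 / 2) (by norm_num)) (hp t ht)
      linarith [hA s (1 / 2) hs.1 h' le_rfl, hB (1 / 2) t le_rfl h ht.2]

/-! ### Curves over Poincaré geodesics -/

lemma mobiusDist_mul_left {ω : ℂ} (hω : ‖ω‖ = 1) (a b : ℂ) :
    mobiusDist (ω * a) (ω * b) = mobiusDist a b := by
  have h : ω * conj ω = 1 := by rw [mul_conj, normSq_eq_norm_sq, hω]; simp
  have h1 : ω * a * conj (ω * b) = a * conj b := by
    rw [map_mul]
    linear_combination a * conj b * h
  rw [mobiusDist, mobiusDist, h1, ← mul_sub, mul_div_assoc, norm_mul, hω, one_mul]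

/-- In the sector `|arg| < π / (2 m)` the `m`-th power has positive real part and is inverted by the
principal `m`-th root. -/
lemma re_pow_pos_and_root {m : ℕ} (hm : 1 ≤ m) {r θ : ℝ} (hr : 0 < r)
    (hθ : |θ| < Real.pi / m / 2) :
    0 < (((r : ℂ) * exp (θ * I)) ^ m).re ∧
      (((r : ℂ) * exp (θ * I)) ^ m) ^ ((m : ℂ)⁻¹) = r * exp (θ * I) := by
  have hm0 : (0 : ℝ) < m := by exact_mod_cast hm
  obtain ⟨h1, h2⟩ := abs_lt.1 hθ
  have hpm : 0 < Real.pi / m := by positivity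
  have hpm' : Real.pi / m ≤ Real.pi := div_le_self Real.pi_pos.le (by exact_mod_cast hm)
  constructor
  · have : ((r : ℂ) * exp (θ * I)) ^ m = (r ^ m : ℝ) * exp ((m * θ : ℝ) * I) := by
      rw [mul_pow, ← Complex.exp_nat_mul]
      push_cast
      ring_nf
    rw [this, re_ofReal_mul, exp_ofReal_mul_I_re]
    have h3 : m * (Real.pi / m / 2) = Real.pi / 2 := by field_simp
    refine mul_pos (pow_pos hr m) (Real.cos_pos_of_mem_Ioo ⟨?_, ?_⟩)
    · nlinarith
    · nlinarith
  · have harg : ((r : ℂ) * exp (θ * I)).arg = θ := by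
      rw [arg_real_mul _ hr, arg_exp_mul_I, toIocMod_eq_self]
      constructor <;> linarith
    exact pow_cpow_nat_inv (by omega) (by rw [harg]; linarith) (by rw [harg]; linarith)

/-- Two points at an angle less than `π / m` are rotated into the sector `|arg| < π / (2 m)`. -/
lemma exists_rotation {m : ℕ} (hm : 1 ≤ m) {a b : ℂ}
    (h : Real.cos (Real.pi / m) * ‖a * b‖ < (a * conj b).re) :
    ∃ ω a' b' : ℂ, ‖ω‖ = 1 ∧ ω * a' = a ∧ ω * b' = b ∧ 0 < (a' ^ m).re ∧ 0 < (b' ^ m).re ∧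
      (a' ^ m) ^ ((m : ℂ)⁻¹) = a' ∧ (b' ^ m) ^ ((m : ℂ)⁻¹) = b' := by
  have ha : a ≠ 0 := by rintro rfl; simp at h
  have hb : b ≠ 0 := by rintro rfl; simp at h
  have ha' : (‖a‖ : ℂ) ≠ 0 := by simpa using ha
  have hm0 : (0 : ℝ) < m := by exact_mod_cast hm
  have hpm : Real.pi / m ≤ Real.pi := div_le_self Real.pi_pos.le (by exact_mod_cast hm)
  set z := b * conj a with hz
  have hz0 : 0 < ‖z‖ := by
    rw [hz, norm_mul, norm_conj]
    exact mul_pos (norm_pos_iff.2 hb) (norm_pos_iff.2 ha)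
  set δ := z.arg with hδ
  have hzδ : (‖z‖ : ℂ) * exp (δ * I) = z := norm_mul_exp_arg_mul_I z
  have hcos : Real.cos (Real.pi / m) < Real.cos |δ| := by
    have h1 : z.re = ‖z‖ * Real.cos δ := by
      rw [← congrArg re hzδ, re_ofReal_mul, exp_ofReal_mul_I_re]
    have h2 : (a * conj b).re = z.re := by
      rw [hz, ← conj_re (b * conj a), map_mul, conj_conj, mul_comm]
    have h3 : ‖a * b‖ = ‖z‖ := by rw [hz, norm_mul, norm_mul, norm_conj, mul_comm]
    rw [h2, h3, h1, mul_comm ‖z‖] at h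
    rw [Real.cos_abs]
    exact lt_of_mul_lt_mul_right h hz0.le
  have hδm : |δ| < Real.pi / m := by
    by_contra! hle
    exact absurd hcos (not_lt.2 (Real.cos_le_cos_of_nonneg_of_le_pi (by positivity)
      (abs_arg_le_pi z) hle))
  have hhalf : |δ / 2| < Real.pi / m / 2 := by
    rw [abs_div, abs_two]
    linarith
  have hhalf' : |-(δ / 2)| < Real.pi / m / 2 := by rwa [abs_neg]
  obtain ⟨ha1, ha2⟩ := re_pow_pos_and_root hm (norm_pos_iff.2 ha) hhalf'
  obtain ⟨hb1, hb2⟩ := re_pow_pos_and_root hm (norm_pos_iff.2 hb) hhalf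
  refine ⟨a / ‖a‖ * exp ((δ / 2 : ℝ) * I), _, _, ?_, ?_, ?_, ha1, hb1, ha2, hb2⟩
  · rw [norm_mul, norm_exp_ofReal_mul_I, norm_div, norm_real, norm_norm,
      div_self (norm_ne_zero_iff.2 ha), one_mul]
  · have : exp ((δ / 2 : ℝ) * I) * exp ((-(δ / 2) : ℝ) * I) = 1 := by
      rw [← Complex.exp_add]
      push_cast
      ring_nf
      exact Complex.exp_zero
    calc _ = a / ‖a‖ * ‖a‖ * (exp ((δ / 2 : ℝ) * I) * exp ((-(δ / 2) : ℝ) * I)) := by ring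
      _ = a := by rw [this, mul_one, div_mul_cancel₀ _ ha']
  · have h1 : exp ((δ / 2 : ℝ) * I) * exp ((δ / 2 : ℝ) * I) = exp (δ * I) := by
      rw [← Complex.exp_add]
      congr 1
      push_cast
      ring
    have h2 : (‖b‖ : ℂ) * ‖a‖ * exp (δ * I) = b * conj a := by
      rw [← hz, ← hzδ, hz, norm_mul, norm_conj, ofReal_mul]
    have h3 : a * conj a = ‖a‖ * ‖a‖ := by
      rw [mul_conj, normSq_eq_norm_sq]
      push_cast
      ring
    calc _ = a / ‖a‖ * ‖b‖ * (exp ((δ / 2 : ℝ) * I) * exp ((δ / 2 : ℝ) * I)) := by ring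
      _ = a * (‖b‖ * ‖a‖ * exp (δ * I)) / (‖a‖ * ‖a‖) := by
        rw [h1]
        field_simp
      _ = b := by
        rw [h2, mul_left_comm, h3, mul_div_cancel_right₀ _ (mul_ne_zero ha' ha')]

/-- The right half of the disc is geodesically convex: the geodesic `t ↦ mobius (-A) (t v)` stays
in it if its end points do. -/
lemma re_mobius_pos {A v : ℂ} (hA1 : ‖A‖ < 1) (hv : ‖v‖ < 1) (hA : 0 < A.re)
    (h1 : 0 < (mobius (-A) v).re) {t : ℝ} (ht : t ∈ Icc (0 : ℝ) 1) :
    0 < (mobius (-A) (t * v)).re := by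
  have hneg : ‖-A‖ < 1 := by rwa [norm_neg]
  have htv : ∀ t ∈ Icc (0 : ℝ) 1, ‖(t : ℂ) * v‖ ≤ 1 := fun t ht ↦ by
    rw [norm_mul, norm_real, Real.norm_of_nonneg ht.1]
    nlinarith [norm_nonneg v, ht.1, ht.2]
  -- Up to a positive factor, the real part is a quadratic polynomial `p t` in `t`.
  let p : ℝ → ℝ := fun t ↦ A.re * (1 + t ^ 2 * normSq v) + t * (v.re + (A ^ 2 * conj v).re)
  have hp : ∀ t ∈ Icc (0 : ℝ) 1,
      (mobius (-A) (t * v)).re = p t / normSq (1 - conj (-A) * (t * v)) := by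
    intro t ht
    rw [mobius, div_re, ← add_div]
    congr 1
    simp only [p, normSq_apply, pow_two, sub_re, sub_im, mul_re, mul_im, neg_re, neg_im, conj_re,
      conj_im, ofReal_re, ofReal_im, one_re, one_im, map_neg]
    ring
  have hden : ∀ t ∈ Icc (0 : ℝ) 1, 0 < normSq (1 - conj (-A) * (t * v)) := fun t ht ↦
    normSq_pos.2 (mobius_den_ne_zero hneg (htv t ht))
  have hp1 : 0 < p 1 := by
    have h2 := hp 1 (by simp)
    rw [ofReal_one, one_mul] at h2
    rw [h2] at h1
    have h3 := hden 1 (by simp)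
    rw [ofReal_one, one_mul] at h3
    exact (div_pos_iff_of_pos_right h3).1 h1
  have hv2 : normSq v < 1 := by
    rw [normSq_eq_norm_sq]
    nlinarith [norm_nonneg v]
  have hle : t * p 1 + A.re * ((1 - t) * (1 - t * normSq v)) = p t := by
    simp only [p]
    ring
  rw [hp t ht]
  refine div_pos ?_ (hden t ht)
  rw [← hle]
  have htn : 0 < 1 - t * normSq v := by nlinarith [ht.1, ht.2, normSq_nonneg v]
  rcases ht.1.eq_or_lt with h0 | h0
  · simpa [← h0] using hA
  · have := mul_pos h0 hp1
    have := mul_nonneg hA.le (mul_nonneg (sub_nonneg.2 ht.2) htn.le)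
    linarith

/-- The upper bound given by the `m`-th root of the Poincaré geodesic between the `m`-th powers,
for two points at an angle less than `π / m`. -/
lemma innerCaratheodoryDist_le_poincareDist {m n : ℕ} (hm : 1 ≤ m) (hmn : m ≤ n)
    {a b : ℂ} (ha : ‖a‖ < 1) (hb : ‖b‖ < 1)
    (h : Real.cos (Real.pi / m) * ‖a * b‖ < (a * conj b).re) :
    innerCaratheodoryDist (parabola m n) (param m n a) (param m n b) ≤
      ENNReal.ofReal (poincareDist (a ^ m) (b ^ m)) := by
  have hn : 1 ≤ n := hm.trans hmn
  have hm0 : m ≠ 0 := by omega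
  obtain ⟨ω, a', b', hω, rfl, rfl, ha0, hb0, har, hbr⟩ := exists_rotation hm h
  rw [norm_mul, hω, one_mul] at ha hb
  set A := a' ^ m with hAdef
  set B := b' ^ m with hBdef
  have hA1 : ‖A‖ < 1 := norm_pow_lt_one hm ha
  have hB1 : ‖B‖ < 1 := norm_pow_lt_one hm hb
  have hneg : ‖-A‖ < 1 := by rwa [norm_neg]
  set v := mobius A B with hv
  have hv1 : ‖v‖ < 1 := norm_mobius_lt_one hA1 hB1
  have hvB : mobius (-A) v = B := mobius_neg_mobius hA1 hB1
  -- `γ` runs through the geodesic from `A` to `B` for real times in `[0, 1]`, and stays in the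
  -- domain of the principal root.
  let γ : ℂ → ℂ := fun z ↦ mobius (-A) (z * v)
  let l : ℂ → ℂ := fun z ↦ ω * γ z ^ ((m : ℂ)⁻¹)
  have htv : ∀ t ∈ Icc (0 : ℝ) 1, ‖(t : ℂ) * v‖ = t * ‖v‖ := fun t ht ↦ by
    rw [norm_mul, norm_real, Real.norm_of_nonneg ht.1]
  have htv1 : ∀ t ∈ Icc (0 : ℝ) 1, t * ‖v‖ < 1 := fun t ht ↦
    (mul_le_of_le_one_left (norm_nonneg v) ht.2).trans_lt hv1
  have htv' : ∀ t ∈ Icc (0 : ℝ) 1, ‖(t : ℂ) * v‖ < 1 := fun t ht ↦ (htv t ht).trans_lt (htv1 t ht)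
  have hγ1 : ∀ t ∈ Icc (0 : ℝ) 1, ‖γ t‖ < 1 := fun t ht ↦ norm_mobius_lt_one hneg (htv' t ht)
  have hγre : ∀ t ∈ Icc (0 : ℝ) 1, 0 < (γ t).re := fun t ht ↦
    re_mobius_pos hA1 hv1 ha0 (by rwa [hvB]) ht
  have hlm : ∀ z, l z ^ m = ω ^ m * γ z := fun z ↦ by
    rw [mul_pow, cpow_nat_inv_pow _ hm0]
  have hlnorm : ∀ z, ‖l z‖ ^ m = ‖γ z‖ := fun z ↦ by
    rw [← norm_pow, hlm, norm_mul, norm_pow, hω, one_pow, one_mul]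
  have hl1 : ∀ t ∈ Icc (0 : ℝ) 1, ‖l t‖ < 1 := fun t ht ↦ by
    by_contra! hle
    exact absurd (hγ1 t ht) (not_lt.2 ((one_le_pow₀ hle).trans_eq (hlnorm t)))
  have hγan : ∀ t ∈ Icc (0 : ℝ) 1, AnalyticAt ℂ γ t := fun t ht ↦
    ((analyticAt_id.mul analyticAt_const).sub analyticAt_const).div
      (analyticAt_const.sub (analyticAt_const.mul (analyticAt_id.mul analyticAt_const)))
      (mobius_den_ne_zero hneg (htv' t ht).le)
  have hlan : ∀ t ∈ Icc (0 : ℝ) 1, AnalyticAt ℂ l t := fun t ht ↦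
    analyticAt_const.mul ((hγan t ht).cpow analyticAt_const (Or.inl (hγre t ht)))
  have hγ' : ∀ t ∈ Icc (0 : ℝ) 1,
      ‖deriv γ t‖ * (1 - (t * ‖v‖) ^ 2) = ‖v‖ * (1 - ‖γ t‖ ^ 2) := by
    intro t ht
    have h1 : HasDerivAt (fun z : ℂ ↦ z * v) v t := by
      simpa using (hasDerivAt_id (t : ℂ)).mul_const v
    have h2 : HasDerivAt γ _ t := HasDerivAt.comp (h₂ := mobius (-A)) (t : ℂ)
      (hasDerivAt_mobius (mobius_den_ne_zero hneg (htv' t ht).le)) h1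
    have h3 := norm_deriv_mobius_mul hneg (htv' t ht).le
    rw [htv t ht] at h3
    rw [h2.deriv, norm_mul, mul_right_comm, h3, mul_comm]
  have hl' : ∀ t ∈ Icc (0 : ℝ) 1, m * ‖l t‖ ^ (m - 1) * ‖deriv l t‖ = ‖deriv γ t‖ := by
    intro t ht
    have h1 := (hlan t ht).differentiableAt.hasDerivAt.pow m
    have h2 := (hγan t ht).differentiableAt.hasDerivAt.const_mul (ω ^ m)
    rw [show l ^ m = fun z ↦ ω ^ m * γ z from funext hlm] at h1
    have h3 := congrArg norm (h1.unique h2)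
    simpa [hω] using h3
  obtain ⟨K, hK⟩ : ∃ K, LipschitzOnWith K (fun t : ℝ ↦ l t) (Icc 0 1) := by
    have hC : ContDiffOn ℝ 1 (fun t : ℝ ↦ l t) (Icc 0 1) := fun t ht ↦
      (((hlan t ht).contDiffAt.restrict_scalars ℝ).comp t
        ofRealCLM.contDiff.contDiffAt).contDiffWithinAt
    exact hC.exists_lipschitzOnWith one_ne_zero (convex_Icc 0 1) isCompact_Icc
  have hle := innerCaratheodoryDist_le hm hn hK hl1 (T := fun t ↦ Real.artanh (t * ‖v‖)) ?_
  · have e0 : l (0 : ℝ) = ω * a' := by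
      simp only [l, γ, ofReal_zero, zero_mul]
      rw [show mobius (-A) 0 = A by simp [mobius], har]
    have e1 : l (1 : ℝ) = ω * b' := by
      simp only [l, γ, ofReal_one, one_mul]
      rw [hvB, hbr]
    have hωm : ‖ω ^ m‖ = 1 := by rw [norm_pow, hω, one_pow]
    have e2 : poincareDist ((ω * a') ^ m) ((ω * b') ^ m) = Real.artanh ‖v‖ := by
      rw [mul_pow, mul_pow, poincareDist, mobiusDist_mul_left hωm, ← poincareDist,
        poincareDist_eq_artanh hA1 hB1, mobiusDist_comm, mobiusDist_eq]
    rw [e2]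
    rwa [e0, e1, one_mul, zero_mul, Real.artanh_zero, sub_zero] at hle
  · intro f hf hf1 s hs t ht hst
    have hI : ∀ x ∈ Icc s t, x ∈ Icc (0 : ℝ) 1 := fun x hx ↦ ⟨hs.1.trans hx.1, hx.2.trans ht.2⟩
    refine poincareDist_le_of_speed_le (k := fun x : ℝ ↦ f (param m n (l x)))
      (k' := fun x ↦ deriv (fun z ↦ f (param m n z)) (l x) * deriv l x)
      (T := fun x ↦ Real.artanh (x * ‖v‖)) (T' := fun x ↦ 1 / (1 - (x * ‖v‖) ^ 2) * ‖v‖) hst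
      (fun x hx ↦ hf1 _ (param_mem_parabola hm hn (hl1 x (hI x hx)))) ?_ ?_ ?_
    · intro x hx
      have h1 := (differentiableOn_comp_param hm hn hf).hasDerivAt
        (isOpen_ball.mem_nhds (mem_ball_zero_iff.2 (hl1 x (hI x hx))))
      exact (HasDerivAt.comp (h₂ := fun z ↦ f (param m n z)) (x : ℂ) h1
        (hlan x (hI x hx)).differentiableAt.hasDerivAt).comp_ofReal
    · intro x hx
      have h2 : HasDerivAt (fun y : ℝ ↦ y * ‖v‖) ‖v‖ x := by
        simpa using (hasDerivAt_id x).mul_const ‖v‖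
      refine HasDerivAt.comp (h₂ := Real.artanh) x (hasDerivAt_artanh ?_) h2
      rw [abs_of_nonneg (mul_nonneg (hI x hx).1 (norm_nonneg v))]
      exact htv1 x (hI x hx)
    · intro x hx
      have hx' := hI x hx
      have h1 := norm_deriv_comp_param_mul_le hm hmn hf hf1 (hl1 x hx')
      rw [mul_comm 2 m, pow_mul, hlnorm] at h1
      have h2 : 0 < 1 - (x * ‖v‖) ^ 2 := by
        nlinarith [htv1 x hx', mul_nonneg hx'.1 (norm_nonneg v)]
      have h3 : 0 < 1 - ‖γ x‖ ^ 2 := by nlinarith [hγ1 x hx', norm_nonneg (γ x)]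
      have h4 := mul_le_mul_of_nonneg_right h1 (norm_nonneg (deriv l x))
      have h5 := mul_le_mul_of_nonneg_right h4 h2.le
      rw [norm_mul, one_div_mul_eq_div, mul_div_assoc', le_div_iff₀ h2]
      refine le_of_mul_le_mul_right ?_ h3
      calc _ = ‖deriv (fun z ↦ f (param m n z)) (l x)‖ * (1 - ‖γ x‖ ^ 2) * ‖deriv l x‖ *
              (1 - (x * ‖v‖) ^ 2) := by ring
        _ ≤ _ := h5
        _ = (1 - ‖f (param m n (l x))‖ ^ 2) * (m * ‖l x‖ ^ (m - 1) * ‖deriv l x‖ *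
              (1 - (x * ‖v‖) ^ 2)) := by ring
        _ = _ := by
          rw [hl' x hx', hγ' x hx']
          ring

end NeilParabola

theorem theorem1 (m n : ℕ) (hm : 1 ≤ m) (hmn : m ≤ n) (hcop : Nat.Coprime m n)
    (l μ : ℂ) (hl : ‖l‖ < 1) (hμ : ‖μ‖ < 1) :
    NeilParabola.innerCaratheodoryDist (NeilParabola.parabola m n)
        (NeilParabola.param m n l) (NeilParabola.param m n μ) =
      ENNReal.ofReal
        (if (l * (starRingEnd ℂ) μ).re ≥ Real.cos (Real.pi / m) * ‖l * μ‖ then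
          NeilParabola.poincareDist (l ^ m) (μ ^ m)
        else
          NeilParabola.poincareDist (l ^ m) 0 + NeilParabola.poincareDist 0 (μ ^ m)) := by
  refine le_antisymm ?_ (le_iInf₂ fun α hα ↦ NeilParabola.le_curveLength hm hmn hcop hl hμ hα)
  split_ifs with h
  · rcases h.lt_or_eq with h | h
    · exact NeilParabola.innerCaratheodoryDist_le_poincareDist hm hmn hl hμ h
    · rw [NeilParabola.poincareDist_pow_eq_add hm hl hμ h.symm]
      exact NeilParabola.innerCaratheodoryDist_le_add hm hmn hl hμ
  · exact NeilParabola.innerCaratheodoryDist_le_add hm hmn hl hμ
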